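/- Write $e_r(z)=\exp(2\pi i z/r)$; $p$ denotes a prime. A pair of real numbers $(\alpha,\beta)$ is called *admissible* if, for every prime $p$ and every integer $\lambda$ with $\gcd(\lambda,p)=1$, $$\max_{\gcd(a,p)=1}\Bigl|\sum_{z=1}^{t}e_p(a\lambda^z)\Bigr|\le t^{\alpha}p^{\beta+o(1)}\qquad(p\to\infty),$$ where $t$ is the multiplicative order of $\lambda$ modulo $p$ and the $o(1)$ is uniform in $\lambda$. Fix an integer $\lambda\ge 2$, let $t_p$ be the order of $\lambda$ modulo $p$ (primes dividing $\lambda$ are left out), and for real $X,\Delta$ put $\mathcal E_\Delta(X)=\{p\le X: t_p\ge\Delta\}$. For an integer $T$, complex numbers $\Gamma=\{\gamma_n\}_{n=1}^T$ and non-negative integers $\mathcal S=\{s_n\}_{n=1}^T$ put $$V_\lambda(\Gamma,\mathcal S;T,X,\Delta)=\sum_{p\in\mathcal E_\Delta(X)}\max_{\gcd(a,p)=1}\Bigl|\sum_{n\le T}\gamma_n e_p(a\lambda^{s_n})\Bigr|^2 .$$ **Theorem.** (i) Let $(\alpha,\beta)$ be an admissible pair with $\alpha<1$ and let $\eta,\delta>0$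 satisfy $\frac{\beta+\eta}{1-\alpha}\le\frac12-\delta$. Suppose that $S>0$, $T$, $X$, $\Delta>1$ and the integer $k\ge1$ satisfy $$T^{1+1/(3-2\alpha)}\ge SX^{2\eta}\quad\text{and}\quad X\le\Bigl(\Bigl(\frac{T}{SX^{2\eta}}\Bigr)^{1/(3-2\alpha)}\Delta\Bigr)^{k}.\tag{1}$$ Then for all complex $\gamma_n$ with $|\gamma_n|\le1$ and all integers $0\le s_1<\dots<s_T\le S$, $$V_\lambda(\Gamma,\mathcal S;T,X,\Delta)\le\Bigl(X+TX^{-\delta/(k^2+2)}+\bigl(S^{2-2\alpha}TX^{-2\eta}\bigr)^{1/(3-2\alpha)}\Bigr)TX^{1+o(1)}\qquad(X\to\infty),$$ where the $o(1)$ may depend on $\lambda,\alpha,\beta,\eta,\delta$ but is uniform in $S,T,\Delta,k,\Gamma,\mathcal S$. (ii) This bound saves a power of $X$ over the trivial bound $XT^2$ for the following pairs $(\alpha,\beta)$ and ranges of $S$. For every $\varepsilon>0$ there are $\eta,\delta,c>0$ and an integer $k\ge1$ with $\frac{\beta+\eta}{1-\alpha}\le\frac12-\delta$ such that for all sufficiently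 large $X$, with $\Delta=X^{1/2}$, all integers $T\ge X^{1+\varepsilon}$ and all $0<S\le X^{\theta-\varepsilon}$, the conditions (1) hold and $$\Bigl(X+TX^{-\delta/(k^2+2)}+\bigl(S^{2-2\alpha}TX^{-2\eta}\bigr)^{1/(3-2\alpha)}\Bigr)TX\le X^{-c}\cdot XT^2,$$ in each of the cases: (a) $(\alpha,\beta)=(5/8,1/8)$ (the exponents of Heath-Brown and Konyagin) and $\theta=7/6$; (b) $(\alpha,\beta)=(1-\vartheta,\zeta\vartheta)$ (the exponents of Bourgain, Glibichuk and Konyagin) and $\theta=3/2$, for all $0<\vartheta\le1/5$ and all $0<\zeta\le\zeta_0$, where $\zeta_0>0$ depends only on $\varepsilon$ (and $\eta,\delta,c,k$ may depend on $\varepsilon,\zeta,\vartheta$). -/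

import Mathlib

namespace ExpSieve

noncomputable section

/-- The additive character `e_r(z) = exp(2 π i z / r)`. -/
def e (r : ℕ) (z : ℤ) : ℂ :=
  Complex.exp (2 * (Real.pi : ℂ) * Complex.I * (z : ℂ) / (r : ℂ))

/-- The multiplicative order of `l` modulo `p`. For a prime `p` dividing `l` the value is `0`. -/
def ord (l : ℤ) (p : ℕ) : ℕ := orderOf (l : ZMod p)

/-- The pair `(α, β)` is admissible: for all primes `p`, all integers `l` and `a` coprime to `p`,
`|∑_{z=1}^{t} e_p(a l^z)| ≤ t^α p^(β + o(1))` as `p → ∞`, where `t` is the order of `l` modulo `p`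
and the `o(1)` depends on `p` only. -/
def Admissible (α β : ℝ) : Prop :=
  ∀ ε : ℝ, 0 < ε → ∃ P : ℕ, ∀ p : ℕ, p.Prime → P ≤ p →
    ∀ l : ℤ, IsCoprime l (p : ℤ) → ∀ a : ℤ, IsCoprime a (p : ℤ) →
      ‖∑ z ∈ Finset.Icc 1 (ord l p), e p (a * l ^ z)‖
        ≤ (ord l p : ℝ) ^ α * (p : ℝ) ^ (β + ε)

/-- The set of primes `p ≤ X` modulo which the order of `l` is at least `Δ`. -/
def primeSet (l : ℤ) (X Δ : ℝ) : Finset ℕ := by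
  classical
  exact (Finset.Icc 1 ⌊X⌋₊).filter (fun p => p.Prime ∧ Δ ≤ (ord l p : ℝ))

/-- The sum over `p` in `primeSet l X Δ` of the maximum over integers `a` coprime to `p` of
`|∑_{n ≤ T} γ_n e_p(a l^{s_n})|^2`. -/
def V (l : ℤ) {T : ℕ} (γ : Fin T → ℂ) (s : Fin T → ℕ) (X Δ : ℝ) : ℝ :=
  ∑ p ∈ primeSet l X Δ,
    ⨆ a : {a : ℤ // IsCoprime a (p : ℤ)}, ‖∑ n : Fin T, γ n * e p ((a : ℤ) * l ^ s n)‖ ^ 2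

/-- The compatibility conditions
`T^(1 + 1/(3-2α)) ≥ S X^(2η)` and `X ≤ ((T / (S X^(2η)))^(1/(3-2α)) Δ)^k`. -/
def Compatible (α η T S X Δ : ℝ) (k : ℕ) : Prop :=
  S * X ^ (2 * η) ≤ T ^ (1 + 1 / (3 - 2 * α)) ∧
  X ≤ ((T / (S * X ^ (2 * η))) ^ (1 / (3 - 2 * α)) * Δ) ^ k

/-- The factor `X + T X^(-δ/(k^2+2)) + (S^(2-2α) T X^(-2η))^(1/(3-2α))`. -/
def boundFactor (α η δ T S X : ℝ) (k : ℕ) : ℝ :=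
  X + T * X ^ (-δ / ((k : ℝ) ^ 2 + 2))
    + (S ^ (2 - 2 * α) * T * X ^ (-(2 * η))) ^ (1 / (3 - 2 * α))

/-- With the exponents `(α, β)` and `Δ = X^(1/2)`, `T ≥ X^(1+ε)`, the parameters `η, δ, k` can be
chosen such that all the conditions hold and the bound `boundFactor * T * X` saves a power of `X`
over the trivial bound `X T^2`, in the range `S ≤ X^(θ-ε)`. -/
def PowerSaving (α β θ ε : ℝ) : Prop :=
  ∃ η δ c X₀ : ℝ, ∃ k : ℕ, 0 < η ∧ 0 < δ ∧ 0 < c ∧ 1 ≤ k ∧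
    (β + η) / (1 - α) ≤ 1 / 2 - δ ∧
    ∀ (X S : ℝ) (T : ℕ), X₀ ≤ X → 0 < S → X ^ (1 + ε) ≤ (T : ℝ) → S ≤ X ^ (θ - ε) →
      Compatible α η T S X (X ^ (1 / 2 : ℝ)) k ∧
      boundFactor α η δ T S X k * T * X ≤ X ^ (-c) * (X * (T : ℝ) ^ 2)

end

end ExpSieve

/-!
Fix a prime `p ≤ X`, let `t` be the order of `l` modulo `p`, and view `f x = e_p(a l ^ x)` as a
function of period `t`. Expanding `f` in its Fourier series over the fractions `q = b / t`, the sum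
`∑ γ_n f(s_n)` becomes `∑ c(q) W(q)` with `W(q) = ∑ γ_n exp(2πi q s_n)`, and the fractions are split
according to their reduced denominators `d ∣ t` at a cut-off `D`.

* Denominators `d ≥ D`: by Cauchy--Schwarz and Bessel's inequality the square of this part is at
  most `∑_{d ∣ t, d ≥ D} ∑_{den q = d} |W(q)|²`, whatever `a` is. A given `d` divides `p - 1` for at
  most `X / d` primes, so a dyadic decomposition and the classical large sieve
  (`large_sieve_redFracs`) bound the sum over `p` by `X T (X + S / D) X ^ o(1)`.
* Denominators `d < D`: by Möbius inversion (`norm_sum_redFracs_le`) this part of `f` is a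
  combination of averages of `f` over progressions of difference `e ∣ t`, `e < D`. Such an average
  is a complete sum over the group generated by `l ^ e`, of order `t / e > t / D`, so admissibility
  bounds it by `(t / D) ^ (α - 1) p ^ (β + o(1))`. The number of terms is controlled by the divisor
  bound. If `t ≥ X ^ (1 / 2 - δ)`, this is at most `D ^ (1 - α) X ^ (-η + o(1))`.

The primes with `t < X ^ (1 / 2 - δ)` divide one of the numbers `l ^ t - 1`, hence number
`O(X ^ (1 - 2δ))` and may be estimated trivially (`card_primes_ord_le`); this loss is absorbed by
`T X ^ (-δ / (k² + 2))`. Finally `D = (S X ^ (2η) / T) ^ (1 / (3 - 2α))` balances the two parts,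
both of which then equal the last term of the bound (`balance_cutoff`). The result is `V_le`.

The power savings reduce to linear inequalities between exponents (`powerSaving_of_exponents`).
-/

namespace ExpSieve

/-! ### Divisors and primes -/

theorem card_primeFactors_le_of_le_two_pow {n m : ℕ} (hn : n ≠ 0) (h : n ≤ 2 ^ m) :
    n.primeFactors.card ≤ m := by
  have h1 : 2 ^ n.primeFactors.card ≤ ∏ p ∈ n.primeFactors, p :=
    Finset.pow_card_le_prod _ _ _ fun p hp => (Nat.prime_of_mem_primeFactors hp).two_le
  have h2 : ∏ p ∈ n.primeFactors, p ≤ n :=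
    Nat.le_of_dvd (Nat.pos_of_ne_zero hn) (Nat.prod_primeFactors_dvd n)
  exact (Nat.pow_le_pow_iff_right (by norm_num)).1 (h1.trans (h2.trans h))

/-- A prime modulo which `l` has order `t > 0` divides `l ^ t - 1`, and that number has at most
`l * t` prime factors. -/
theorem card_primes_ord_le {l : ℤ} (hl : 2 ≤ l) (A : Finset ℕ) (Y : ℝ) (hY : 0 ≤ Y)
    (hA : ∀ p ∈ A, p.Prime ∧ 0 < ord l p ∧ (ord l p : ℝ) ≤ Y) :
    (A.card : ℝ) ≤ l * Y ^ 2 := by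
  obtain ⟨L, rfl⟩ : ∃ L : ℕ, l = L := ⟨l.toNat, by omega⟩
  have hL : 2 ≤ L := by exact_mod_cast hl
  have hsub : A ⊆ (Finset.Icc 1 ⌊Y⌋₊).biUnion fun t => (L ^ t - 1).primeFactors := by
    intro p hp
    obtain ⟨h1, h2, h3⟩ := hA p hp
    have hlt : 1 < L ^ ord (L : ℤ) p := Nat.one_lt_pow h2.ne' (by omega)
    rw [Finset.mem_biUnion]
    refine ⟨ord L p, Finset.mem_Icc.2 ⟨h2, Nat.le_floor h3⟩, ?_⟩
    rw [Nat.mem_primeFactors]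
    refine ⟨h1, ?_, by omega⟩
    have h4 : ((L : ZMod p)) ^ ord (L : ℤ) p = 1 := by
      simp [ord]
    rw [← ZMod.natCast_eq_zero_iff, Nat.cast_sub hlt.le]
    simp [h4]
  have hcard : A.card ≤ ∑ t ∈ Finset.Icc 1 ⌊Y⌋₊, L * t := by
    refine (Finset.card_le_card hsub).trans (Finset.card_biUnion_le.trans ?_)
    refine Finset.sum_le_sum fun t ht => ?_
    have ht1 := (Finset.mem_Icc.1 ht).1
    have hlt : 1 < L ^ t := Nat.one_lt_pow (by omega) (by omega)
    refine card_primeFactors_le_of_le_two_pow (by omega) ?_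
    calc L ^ t - 1 ≤ L ^ t := Nat.sub_le _ _
      _ ≤ (2 ^ L) ^ t := Nat.pow_le_pow_left Nat.lt_two_pow_self.le _
      _ = 2 ^ (L * t) := (pow_mul _ _ _).symm
  have hbd : ∑ t ∈ Finset.Icc 1 ⌊Y⌋₊, L * t ≤ L * ⌊Y⌋₊ ^ 2 := by
    calc ∑ t ∈ Finset.Icc 1 ⌊Y⌋₊, L * t ≤ ∑ t ∈ Finset.Icc 1 ⌊Y⌋₊, L * ⌊Y⌋₊ :=
          Finset.sum_le_sum fun t ht => Nat.mul_le_mul_left _ (Finset.mem_Icc.1 ht).2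
      _ = L * ⌊Y⌋₊ ^ 2 := by simp; ring
  calc (A.card : ℝ) ≤ ((L * ⌊Y⌋₊ ^ 2 : ℕ) : ℝ) := by exact_mod_cast hcard.trans hbd
    _ = L * (⌊Y⌋₊ : ℝ) ^ 2 := by push_cast; ring
    _ ≤ ((L : ℤ) : ℝ) * Y ^ 2 := by
        push_cast
        gcongr
        exact Nat.floor_le hY

theorem card_filter_dvd_sub_one_le (X : ℝ) (d : ℕ) (hd : 0 < d) (A : Finset ℕ)
    (hX : 0 ≤ X) (hA : ∀ p ∈ A, 2 ≤ p ∧ (p : ℝ) ≤ X ∧ d ∣ p - 1) : (A.card : ℝ) ≤ X / d := by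
  have hsub : A ⊆ (Finset.Icc 1 ⌊X / d⌋₊).image fun m => m * d + 1 := by
    intro p hp
    obtain ⟨h2, hpX, m, hm⟩ := hA p hp
    have hpm : p = m * d + 1 := by rw [mul_comm]; omega
    rw [Finset.mem_image]
    refine ⟨m, Finset.mem_Icc.2 ⟨?_, Nat.le_floor ?_⟩, hpm.symm⟩
    · rcases Nat.eq_zero_or_pos m with h | h
      · subst h; simp at hpm; omega
      · exact h
    · rw [le_div_iff₀ (by exact_mod_cast hd)]
      have : (p : ℝ) = m * d + 1 := by exact_mod_cast hpm
      linarith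
  have h1 := (Finset.card_le_card hsub).trans Finset.card_image_le
  rw [Nat.card_Icc, Nat.add_sub_cancel] at h1
  exact (Nat.cast_le.2 h1).trans (Nat.floor_le (by positivity))

/-- The divisor bound `τ(n) ≪ n ^ ε`. Primes above `2 ^ (1 / ε)` contribute a factor at most `1` to
`τ(n) / n ^ ε`, and each of the boundedly many smaller ones a bounded factor. -/
theorem exists_card_divisors_le_rpow (ε : ℝ) (hε : 0 < ε) :
    ∃ C : ℝ, 1 ≤ C ∧ ∀ n : ℕ, n ≠ 0 → (n.divisors.card : ℝ) ≤ C * (n : ℝ) ^ ε := by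
  set Q : ℕ := ⌈(2 : ℝ) ^ (1 / ε)⌉₊ with hQ
  set K : ℝ := max 1 (1 / (ε * Real.log 2)) with hK
  have hK1 : 1 ≤ K := le_max_left _ _
  have hlog2 : 0 < Real.log 2 := Real.log_pos (by norm_num)
  refine ⟨K ^ Q, one_le_pow₀ hK1, fun n hn => ?_⟩
  have hfac : (n : ℝ) ^ ε = ∏ p ∈ n.primeFactors, ((p : ℝ) ^ ε) ^ n.factorization p := by
    conv_lhs => rw [← Nat.prod_factorization_pow_eq_self hn, Nat.prod_factorization_eq_prod_primeFactors]
    push_cast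
    rw [← Real.finsetProd_rpow _ _ (fun i _ => by positivity)]
    refine Finset.prod_congr rfl fun p _ => ?_
    rw [← Real.rpow_natCast, ← Real.rpow_natCast, ← Real.rpow_mul (by positivity),
      ← Real.rpow_mul (by positivity), mul_comm]
  have hterm : ∀ p ∈ n.primeFactors, ((n.factorization p + 1 : ℕ) : ℝ)
      ≤ (if p < Q then K else 1) * ((p : ℝ) ^ ε) ^ n.factorization p := by
    intro p hp
    have hp2 : (2 : ℝ) ≤ p := by exact_mod_cast (Nat.prime_of_mem_primeFactors hp).two_le
    set a := n.factorization p
    split_ifs with h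
    · -- `K * 2 ^ (ε a) ≥ K * (1 + ε a log 2) ≥ 1 + a`
      have h1 : 1 + (a : ℝ) * (ε * Real.log 2) ≤ ((p : ℝ) ^ ε) ^ a := by
        calc 1 + (a : ℝ) * (ε * Real.log 2) ≤ Real.exp (a * (ε * Real.log 2)) := by
              linarith [Real.add_one_le_exp ((a : ℝ) * (ε * Real.log 2))]
          _ = ((2 : ℝ) ^ ε) ^ a := by
              rw [Real.rpow_def_of_pos (by norm_num), ← Real.exp_nat_mul]; ring_nf
          _ ≤ _ := by gcongr
      have h2 : 1 ≤ K * (ε * Real.log 2) := by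
        have : 1 / (ε * Real.log 2) ≤ K := le_max_right _ _
        rwa [div_le_iff₀ (by positivity)] at this
      calc ((a + 1 : ℕ) : ℝ) = a * 1 + 1 := by push_cast; ring
        _ ≤ a * (K * (ε * Real.log 2)) + K := by gcongr
        _ = K * (1 + (a : ℝ) * (ε * Real.log 2)) := by ring
        _ ≤ _ := by gcongr
    · have h1 : (2 : ℝ) ≤ (p : ℝ) ^ ε := by
        have h3 : (2 : ℝ) ^ (1 / ε) ≤ p :=
          (Nat.le_ceil _).trans (by exact_mod_cast not_lt.1 h)
        calc (2 : ℝ) = ((2 : ℝ) ^ (1 / ε)) ^ ε := by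
              rw [← Real.rpow_mul (by norm_num), one_div_mul_cancel hε.ne', Real.rpow_one]
          _ ≤ _ := by gcongr
      calc ((a + 1 : ℕ) : ℝ) ≤ ((2 ^ a : ℕ) : ℝ) := by exact_mod_cast Nat.lt_two_pow_self
        _ = (2 : ℝ) ^ a := by push_cast; rfl
        _ ≤ _ := by rw [one_mul]; gcongr
  rw [Nat.card_divisors hn, hfac]
  push_cast
  calc ∏ p ∈ n.primeFactors, ((n.factorization p : ℝ) + 1)
      ≤ ∏ p ∈ n.primeFactors, ((if p < Q then K else 1) * ((p : ℝ) ^ ε) ^ n.factorization p) :=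
        Finset.prod_le_prod (fun _ _ => by positivity) fun p hp => by
          have := hterm p hp
          push_cast at this
          exact this
    _ = (∏ p ∈ n.primeFactors, (if p < Q then K else 1)) *
          ∏ p ∈ n.primeFactors, ((p : ℝ) ^ ε) ^ n.factorization p := Finset.prod_mul_distrib
    _ ≤ _ := by
      gcongr
      rw [Finset.prod_ite, Finset.prod_const_one, mul_one, Finset.prod_const]
      refine pow_le_pow_right₀ hK1 ?_
      calc _ ≤ (Finset.range Q).card := Finset.card_le_card fun p hp => by
            simpa using (Finset.mem_filter.1 hp).2
        _ = Q := by simp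

/-! ### The additive character and the duality principle -/

/-- The additive character `θ ↦ exp(2πiθ)` of `ℝ / ℤ`. -/
noncomputable def ec (θ : ℝ) : ℂ := Complex.exp (2 * Real.pi * θ * Complex.I)

theorem ec_add (x y : ℝ) : ec (x + y) = ec x * ec y := by
  rw [ec, ec, ec, ← Complex.exp_add]; push_cast; ring_nf

@[simp] theorem norm_ec (x : ℝ) : ‖ec x‖ = 1 := by
  rw [ec, show (2 * Real.pi * x * Complex.I : ℂ) = ((2 * Real.pi * x : ℝ) : ℂ) * Complex.I by
    push_cast; ring]
  exact Complex.norm_exp_ofReal_mul_I _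

@[simp] theorem ec_zero : ec 0 = 1 := by simp [ec]

@[simp] theorem ec_intCast (k : ℤ) : ec k = 1 := by
  rw [ec, Complex.exp_eq_one_iff]
  exact ⟨k, by push_cast; ring⟩

theorem conj_ec (x : ℝ) : (starRingEnd ℂ) (ec x) = ec (-x) := by
  rw [ec, ec, ← Complex.exp_conj]
  simp [Complex.conj_ofNat]

theorem ec_nat_mul (n : ℕ) (x : ℝ) : ec (n * x) = ec x ^ n := by
  rw [ec, ec, ← Complex.exp_nat_mul]; push_cast; ring_nf

theorem ec_eq_one_iff (x : ℝ) : ec x = 1 ↔ ∃ k : ℤ, x = k := by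
  constructor
  · intro h
    rw [ec, Complex.exp_eq_one_iff] at h
    obtain ⟨k, hk⟩ := h
    refine ⟨k, ?_⟩
    have h2 : (2 * Real.pi * Complex.I : ℂ) ≠ 0 := Complex.two_pi_I_ne_zero
    have : (x : ℂ) = k := by
      apply mul_left_cancel₀ h2
      linear_combination hk
    exact_mod_cast this
  · rintro ⟨k, rfl⟩; simp

theorem ec_fract (x : ℝ) : ec (Int.fract x) = ec x := by
  conv_rhs => rw [← Int.fract_add_floor x, ec_add, ec_intCast, mul_one]

theorem norm_ec_sub_one (x : ℝ) : ‖ec x - 1‖ = 2 * |Real.sin (Real.pi * x)| := by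
  rw [ec, show (2 * Real.pi * x * Complex.I : ℂ) = Complex.I * ((2 * Real.pi * x : ℝ) : ℂ) by
    push_cast; ring, Complex.norm_exp_I_mul_ofReal_sub_one]
  rw [norm_mul, Real.norm_eq_abs, Real.norm_eq_abs, abs_two]
  ring_nf

/-- The duality principle combined with Schur's test. -/
theorem sum_sq_norm_le_of_row_sum_le {ι κ : Type*} (A : Finset ι) (B : Finset κ) (M : ι → κ → ℂ)
    (K : ℝ) (hK : 0 ≤ K)
    (h : ∀ i ∈ A, ∑ j ∈ A, ‖∑ n ∈ B, M i n * (starRingEnd ℂ) (M j n)‖ ≤ K) (c : κ → ℂ) :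
    ∑ i ∈ A, ‖∑ n ∈ B, M i n * c n‖ ^ 2 ≤ K * ∑ n ∈ B, ‖c n‖ ^ 2 := by
  set G : ι → ι → ℂ := fun i j => ∑ n ∈ B, M i n * (starRingEnd ℂ) (M j n) with hG
  have hGsymm : ∀ i j, ‖G i j‖ = ‖G j i‖ := by
    intro i j
    rw [← Complex.norm_conj (G j i)]
    simp only [hG, map_sum, map_mul, Complex.conj_conj]
    congr 1
    exact Finset.sum_congr rfl fun n _ => mul_comm _ _
  have hdual : ∀ b : ι → ℂ, ∑ n ∈ B, ‖∑ i ∈ A, b i * M i n‖ ^ 2 ≤ K * ∑ i ∈ A, ‖b i‖ ^ 2 := by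
    intro b
    have h1 : ((∑ n ∈ B, ‖∑ i ∈ A, b i * M i n‖ ^ 2 : ℝ) : ℂ)
        = ∑ i ∈ A, ∑ j ∈ A, b i * (starRingEnd ℂ) (b j) * G i j := by
      push_cast
      simp_rw [← Complex.mul_conj', map_sum, map_mul, Finset.sum_mul_sum, hG, Finset.mul_sum]
      rw [Finset.sum_comm]
      refine Finset.sum_congr rfl fun i _ => ?_
      rw [Finset.sum_comm]
      refine Finset.sum_congr rfl fun j _ => Finset.sum_congr rfl fun n _ => ?_
      ring
    have h2 : ∑ n ∈ B, ‖∑ i ∈ A, b i * M i n‖ ^ 2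
        ≤ ∑ i ∈ A, ∑ j ∈ A, (‖b i‖ ^ 2 * ‖G i j‖ + ‖b j‖ ^ 2 * ‖G j i‖) / 2 := by
      calc ∑ n ∈ B, ‖∑ i ∈ A, b i * M i n‖ ^ 2
          = ‖((∑ n ∈ B, ‖∑ i ∈ A, b i * M i n‖ ^ 2 : ℝ) : ℂ)‖ := by
            rw [Complex.norm_real, Real.norm_of_nonneg (Finset.sum_nonneg fun _ _ => sq_nonneg _)]
        _ ≤ ∑ i ∈ A, ∑ j ∈ A, ‖b i * (starRingEnd ℂ) (b j) * G i j‖ := by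
            rw [h1]
            exact (norm_sum_le _ _).trans (Finset.sum_le_sum fun i _ => norm_sum_le _ _)
        _ ≤ _ := by
            refine Finset.sum_le_sum fun i _ => Finset.sum_le_sum fun j _ => ?_
            rw [norm_mul, norm_mul, Complex.norm_conj, ← hGsymm i j]
            nlinarith [mul_nonneg (sq_nonneg (‖b i‖ - ‖b j‖)) (norm_nonneg (G i j))]
    refine h2.trans ?_
    simp_rw [add_div, Finset.sum_add_distrib]
    rw [Finset.sum_comm (f := fun i j => ‖b j‖ ^ 2 * ‖G j i‖ / 2), ← two_mul, Finset.mul_sum,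
      Finset.mul_sum]
    refine Finset.sum_le_sum fun i hi => ?_
    rw [← Finset.sum_div, ← Finset.mul_sum]
    have := mul_le_mul_of_nonneg_left (h i hi) (sq_nonneg ‖b i‖)
    linarith
  set S : ι → ℂ := fun i => ∑ n ∈ B, M i n * c n with hS
  set R := ∑ i ∈ A, ‖S i‖ ^ 2 with hR
  have hR0 : 0 ≤ R := Finset.sum_nonneg fun _ _ => sq_nonneg _
  have hC0 : 0 ≤ ∑ n ∈ B, ‖c n‖ ^ 2 := Finset.sum_nonneg fun _ _ => sq_nonneg _
  have h3 : (R : ℂ) = ∑ n ∈ B, c n * ∑ i ∈ A, (starRingEnd ℂ) (S i) * M i n := by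
    rw [hR]
    push_cast
    simp_rw [← Complex.mul_conj', Finset.mul_sum]
    rw [Finset.sum_comm]
    refine Finset.sum_congr rfl fun i _ => ?_
    conv_lhs => rw [hS]
    simp only [Finset.sum_mul]
    exact Finset.sum_congr rfl fun n _ => by ring
  have h4 : R ≤ ∑ n ∈ B, ‖c n‖ * ‖∑ i ∈ A, (starRingEnd ℂ) (S i) * M i n‖ := by
    calc R = ‖(R : ℂ)‖ := by rw [Complex.norm_real, Real.norm_of_nonneg hR0]
      _ ≤ _ := by
        rw [h3]
        exact (norm_sum_le _ _).trans (Finset.sum_le_sum fun n _ => (norm_mul _ _).le)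
  have h5 : R ^ 2 ≤ (∑ n ∈ B, ‖c n‖ ^ 2) * (K * R) := by
    have h6 := hdual fun i => (starRingEnd ℂ) (S i)
    simp only [Complex.norm_conj] at h6
    calc R ^ 2 ≤ (∑ n ∈ B, ‖c n‖ * ‖∑ i ∈ A, (starRingEnd ℂ) (S i) * M i n‖) ^ 2 := by gcongr
      _ ≤ _ := Finset.sum_mul_sq_le_sq_mul_sq _ _ _
      _ ≤ _ := by gcongr
  rcases hR0.eq_or_lt with h0 | h0
  · rw [← h0]
    positivity
  · exact le_of_mul_le_mul_right (by nlinarith) h0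

/-! ### The large sieve inequality -/

theorem norm_geom_sum_ec_le (N : ℕ) (x : ℝ) (hx : 0 < Int.fract x) :
    ‖∑ n ∈ Finset.range N, ec (n * x)‖ ≤ (1 / Int.fract x + 1 / (1 - Int.fract x)) / 2 := by
  set y := Int.fract x with hy
  have hy1 : y < 1 := Int.fract_lt_one x
  have hne : ec x ≠ 1 := by
    rw [Ne, ec_eq_one_iff]
    rintro ⟨k, rfl⟩
    simp at hy
    linarith
  have hsin : 2 * min y (1 - y) ≤ |Real.sin (Real.pi * y)| := by
    refine le_trans ?_ (le_abs_self _)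
    have key : ∀ z : ℝ, 0 ≤ z → z ≤ 1 / 2 → 2 * z ≤ Real.sin (Real.pi * z) := by
      intro z h0 h1
      have := Real.mul_le_sin (x := Real.pi * z) (by positivity) (by nlinarith [Real.pi_pos])
      calc 2 * z = 2 / Real.pi * (Real.pi * z) := by field_simp
        _ ≤ _ := this
    rcases le_total y (1 / 2) with h | h
    · exact (mul_le_mul_of_nonneg_left (min_le_left _ _) (by norm_num)).trans (key y hx.le h)
    · rw [show Real.pi * y = Real.pi - Real.pi * (1 - y) by ring, Real.sin_pi_sub]
      exact (mul_le_mul_of_nonneg_left (min_le_right _ _) (by norm_num)).trans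
        (key _ (by linarith) (by linarith))
  have hmin : 0 < min y (1 - y) := lt_min hx (by linarith)
  simp_rw [ec_nat_mul]
  rw [geom_sum_eq hne, norm_div, ← ec_fract x, ← hy, norm_ec_sub_one]
  have hnum : ‖ec y ^ N - 1‖ ≤ 2 := by
    refine (norm_sub_le _ _).trans ?_
    simp
    norm_num
  calc ‖ec y ^ N - 1‖ / (2 * |Real.sin (Real.pi * y)|) ≤ 2 / (2 * (2 * min y (1 - y))) := by
        gcongr
    _ = 1 / min y (1 - y) / 2 := by field_simp
    _ ≤ _ := by
      gcongr
      have h1 : 0 < 1 / y := by positivity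
      have h2 : 0 < 1 / (1 - y) := one_div_pos.2 (by linarith)
      rcases min_choice y (1 - y) with h | h <;> rw [h] <;> linarith

/-- Separated points of `[δ, 1]` are, up to a factor, multiples of `δ`, so the sum of their inverses
is at most a harmonic sum. -/
theorem sum_one_div_le_of_separated {ι : Type*} (A : Finset ι) (u : ι → ℝ) (δ : ℝ) (hδ : 0 < δ)
    (hδ1 : δ ≤ 1) (hu : ∀ i ∈ A, δ ≤ u i ∧ u i ≤ 1)
    (hsep : ∀ i ∈ A, ∀ j ∈ A, i ≠ j → δ ≤ |u i - u j|) :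
    ∑ i ∈ A, 1 / u i ≤ δ⁻¹ * (1 + Real.log δ⁻¹) := by
  have hinj : Set.InjOn (fun i => ⌊u i / δ⌋₊) (A : Set ι) := by
    intro i hi j hj hij
    by_contra hne
    have h1 := hsep i hi j hj hne
    have hi0 : 0 ≤ u i / δ := div_nonneg (hδ.le.trans (hu i hi).1) hδ.le
    have hj0 : 0 ≤ u j / δ := div_nonneg (hδ.le.trans (hu j hj).1) hδ.le
    simp only at hij
    have a1 := Nat.floor_le hi0
    have a2 := Nat.lt_floor_add_one (u i / δ)
    have b1 := Nat.floor_le hj0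
    have b2 := Nat.lt_floor_add_one (u j / δ)
    rw [hij] at a1 a2
    have : |u i / δ - u j / δ| < 1 := by rw [abs_lt]; constructor <;> linarith
    rw [← sub_div, abs_div, abs_of_pos hδ, div_lt_one hδ] at this
    linarith
  calc ∑ i ∈ A, 1 / u i ≤ ∑ i ∈ A, δ⁻¹ * ((⌊u i / δ⌋₊ : ℝ))⁻¹ := by
        refine Finset.sum_le_sum fun i hi => ?_
        have h1 : 1 ≤ ⌊u i / δ⌋₊ := Nat.le_floor (by
          rw [le_div_iff₀ hδ]; simpa using (hu i hi).1)
        have h2 : (⌊u i / δ⌋₊ : ℝ) * δ ≤ u i := by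
          rw [← le_div_iff₀ hδ]
          exact Nat.floor_le (div_nonneg (hδ.le.trans (hu i hi).1) hδ.le)
        have h3 : (0 : ℝ) < ⌊u i / δ⌋₊ := by exact_mod_cast h1
        calc 1 / u i ≤ 1 / ((⌊u i / δ⌋₊ : ℝ) * δ) := by gcongr
          _ = _ := by field_simp
    _ = δ⁻¹ * ∑ m ∈ A.image fun i => ⌊u i / δ⌋₊, (m : ℝ)⁻¹ := by
        rw [Finset.sum_image hinj, Finset.mul_sum]
    _ ≤ δ⁻¹ * ∑ m ∈ Finset.Icc 1 ⌊δ⁻¹⌋₊, (m : ℝ)⁻¹ := by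
        gcongr
        intro m hm
        obtain ⟨i, hi, rfl⟩ := Finset.mem_image.1 hm
        refine Finset.mem_Icc.2 ⟨Nat.le_floor ?_, Nat.floor_le_floor ?_⟩
        · rw [le_div_iff₀ hδ]; simpa using (hu i hi).1
        · rw [div_eq_mul_inv]
          exact mul_le_of_le_one_left (by positivity) (hu i hi).2
    _ ≤ δ⁻¹ * (1 + Real.log δ⁻¹) := by
        gcongr
        have := harmonic_floor_le_one_add_log δ⁻¹ ((one_le_inv₀ hδ).2 hδ1)
        rw [harmonic_eq_sum_Icc] at this
        push_cast at this
        exact this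

/-- The analytic large sieve inequality, with a logarithmic loss, for points that are `δ`-separated
modulo `1`. -/
theorem large_sieve {ι : Type*} (A : Finset ι) (x : ι → ℝ) (δ : ℝ) (hδ : 0 < δ) (hδ1 : δ ≤ 1)
    (hsep : ∀ i ∈ A, ∀ j ∈ A, i ≠ j → δ ≤ Int.fract (x i - x j)) (N : ℕ) (c : ℕ → ℂ) :
    ∑ i ∈ A, ‖∑ n ∈ Finset.range N, ec (n * x i) * c n‖ ^ 2
      ≤ (N + δ⁻¹ * (1 + Real.log δ⁻¹)) * ∑ n ∈ Finset.range N, ‖c n‖ ^ 2 := by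
  classical
  have hlog : 0 ≤ Real.log δ⁻¹ := Real.log_nonneg ((one_le_inv₀ hδ).2 hδ1)
  refine sum_sq_norm_le_of_row_sum_le A (Finset.range N) (fun i n => ec (n * x i)) _
    (by positivity) (fun i hi => ?_) c
  have hG : ∀ j, ∑ n ∈ Finset.range N, ec (n * x i) * (starRingEnd ℂ) (ec (n * x j))
      = ∑ n ∈ Finset.range N, ec (n * (x i - x j)) := by
    intro j
    refine Finset.sum_congr rfl fun n _ => ?_
    rw [conj_ec, ← ec_add]
    congr 1
    ring
  simp_rw [hG]
  rw [← Finset.add_sum_erase A _ hi]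
  refine add_le_add ?_ ?_
  · simp
  · set u : ι → ℝ := fun j => Int.fract (x i - x j) with hu
    have hmem : ∀ j ∈ A.erase i, δ ≤ u j ∧ δ ≤ 1 - u j := by
      intro j hj
      obtain ⟨hne, hjA⟩ := Finset.mem_erase.1 hj
      have h1 := hsep i hi j hjA hne.symm
      have h2 := hsep j hjA i hi hne
      refine ⟨h1, ?_⟩
      have h3 : Int.fract (x i - x j) ≠ 0 := (hδ.trans_le h1).ne'
      rwa [← neg_sub, Int.fract_neg h3] at h2
    have husep : ∀ j ∈ A.erase i, ∀ k ∈ A.erase i, j ≠ k → δ ≤ |u j - u k| := by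
      have key : ∀ j ∈ A, ∀ k ∈ A, j ≠ k → u k ≤ u j → δ ≤ |u j - u k| := by
        intro j hj k hk hne hle
        have h1 := hsep k hk j hj hne.symm
        have h2 : Int.fract (x k - x j) = u j - u k := by
          rw [Int.fract_eq_iff]
          refine ⟨by linarith, ?_, ⌊x i - x j⌋ - ⌊x i - x k⌋, ?_⟩
          · have a := Int.fract_lt_one (x i - x j)
            have b := Int.fract_nonneg (x i - x k)
            simp only [hu]
            linarith
          · simp only [hu, Int.fract]
            push_cast
            ring
        rw [← h2]
        exact h1.trans (le_abs_self _)
      intro j hj k hk hne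
      rcases le_total (u k) (u j) with h | h
      · exact key j (Finset.mem_of_mem_erase hj) k (Finset.mem_of_mem_erase hk) hne h
      · rw [abs_sub_comm]
        exact key k (Finset.mem_of_mem_erase hk) j (Finset.mem_of_mem_erase hj) hne.symm h
    have hs1 := sum_one_div_le_of_separated (A.erase i) u δ hδ hδ1
      (fun j hj => ⟨(hmem j hj).1, (Int.fract_lt_one _).le⟩) husep
    have hs2 := sum_one_div_le_of_separated (A.erase i) (fun j => 1 - u j) δ hδ hδ1
      (fun j hj => ⟨(hmem j hj).2, by linarith [hmem j hj, hδ.trans_le (hmem j hj).1]⟩)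
      (fun j hj k hk hne => by
        rw [show 1 - u j - (1 - u k) = u k - u j by ring]
        exact husep k hk j hj hne.symm)
    calc ∑ j ∈ A.erase i, ‖∑ n ∈ Finset.range N, ec (n * (x i - x j))‖
        ≤ ∑ j ∈ A.erase i, (1 / u j + 1 / (1 - u j)) / 2 :=
          Finset.sum_le_sum fun j hj => norm_geom_sum_ec_le N _ (hδ.trans_le (hmem j hj).1)
      _ ≤ _ := by
        rw [← Finset.sum_div, Finset.sum_add_distrib]
        linarith

/-- The fractions `b / n` with `0 ≤ b < n`. -/
def fracs (n : ℕ) : Finset ℚ := (Finset.range n).image fun b : ℕ => (b : ℚ) / n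

/-- The fractions in `[0, 1)` that have denominator `d` in lowest terms. -/
def redFracs (d : ℕ) : Finset ℚ := (fracs d).filter fun q => q.den = d

theorem mem_fracs {n : ℕ} (hn : 0 < n) {q : ℚ} : q ∈ fracs n ↔ 0 ≤ q ∧ q < 1 ∧ q.den ∣ n := by
  have hn' : (0 : ℚ) < n := by exact_mod_cast hn
  rw [fracs, Finset.mem_image]
  constructor
  · rintro ⟨b, hb, rfl⟩
    have hb' : (b : ℚ) < n := by exact_mod_cast Finset.mem_range.1 hb
    refine ⟨by positivity, (div_lt_one hn').2 hb', ?_⟩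
    have := Rat.den_dvd (b : ℤ) (n : ℤ)
    rw [Rat.divInt_eq_div] at this
    push_cast at this
    exact_mod_cast this
  · rintro ⟨h0, h1, m, hm⟩
    have hnum : ((q.num.toNat : ℕ) : ℚ) = q.num := by
      have : ((q.num.toNat : ℕ) : ℤ) = q.num := Int.toNat_of_nonneg (Rat.num_nonneg.2 h0)
      exact_mod_cast this
    have hq : ((q.num.toNat * m : ℕ) : ℚ) / n = q := by
      rw [div_eq_iff hn'.ne', hm]
      push_cast
      rw [hnum, ← mul_assoc, Rat.mul_den_eq_num]
    refine ⟨q.num.toNat * m, ?_, hq⟩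
    rw [Finset.mem_range]
    rw [← hq, div_lt_one hn'] at h1
    exact_mod_cast h1

theorem mem_redFracs {d : ℕ} (hd : 0 < d) {q : ℚ} :
    q ∈ redFracs d ↔ 0 ≤ q ∧ q < 1 ∧ q.den = d := by
  rw [redFracs, Finset.mem_filter, mem_fracs hd]
  constructor
  · rintro ⟨⟨a, b, -⟩, c⟩; exact ⟨a, b, c⟩
  · rintro ⟨a, b, c⟩; exact ⟨⟨a, b, c.dvd⟩, c⟩

theorem sum_fracs {M : Type*} [AddCommMonoid M] {n : ℕ} (hn : 0 < n) (h : ℚ → M) :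
    ∑ q ∈ fracs n, h q = ∑ b ∈ Finset.range n, h ((b : ℚ) / n) := by
  have hn' : (n : ℚ) ≠ 0 := by exact_mod_cast hn.ne'
  refine Finset.sum_image fun a _ b _ hab => ?_
  rw [div_left_inj' hn'] at hab
  exact_mod_cast hab

theorem sum_fracs_eq_sum_divisors {M : Type*} [AddCommMonoid M] {n : ℕ} (hn : 0 < n)
    (h : ℚ → M) : ∑ q ∈ fracs n, h q = ∑ d ∈ n.divisors, ∑ q ∈ redFracs d, h q := by
  rw [← Finset.sum_fiberwise_of_maps_to (s := fracs n) (t := n.divisors) (g := Rat.den)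
    fun q hq => Nat.mem_divisors.2 ⟨((mem_fracs hn).1 hq).2.2, hn.ne'⟩]
  refine Finset.sum_congr rfl fun d hd => Finset.sum_congr ?_ fun _ _ => rfl
  obtain ⟨hdn, -⟩ := Nat.mem_divisors.1 hd
  ext q
  rw [Finset.mem_filter, mem_fracs hn, mem_redFracs (Nat.pos_of_dvd_of_pos hdn hn)]
  constructor
  · rintro ⟨⟨a, b, -⟩, c⟩; exact ⟨a, b, c⟩
  · rintro ⟨a, b, c⟩; exact ⟨⟨a, b, c ▸ hdn⟩, c⟩

/-- Distinct fractions with denominators at most `Q` are `1 / Q ^ 2` apart modulo `1`. -/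
theorem one_div_le_fract_sub {q r : ℚ} (hq0 : 0 ≤ q) (hq1 : q < 1) (hr0 : 0 ≤ r) (hr1 : r < 1)
    (hne : q ≠ r) {Q : ℕ} (hqQ : q.den ≤ Q) (hrQ : r.den ≤ Q) :
    ((Q : ℝ) ^ 2)⁻¹ ≤ Int.fract ((q : ℝ) - r) := by
  have hf : (0 : ℚ) < Int.fract (q - r) := by
    refine lt_of_le_of_ne (Int.fract_nonneg _) fun h => hne ?_
    obtain ⟨k, hk⟩ := Int.fract_eq_zero_iff.1 h.symm
    have h1 : (k : ℚ) < 1 := by linarith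
    have h2 : (-1 : ℚ) < k := by linarith
    have h3 : k < 1 := by exact_mod_cast h1
    have h4 : -1 < k := by exact_mod_cast h2
    have h5 : k = 0 := by omega
    rw [h5] at hk
    push_cast at hk
    linarith
  have hQ : ((Q : ℚ) ^ 2)⁻¹ ≤ Int.fract (q - r) := by
    have hpos : (0 : ℚ) < q.den * r.den := by
      have := q.den_pos
      have := r.den_pos
      positivity
    have hint : ∃ k : ℤ, Int.fract (q - r) * (q.den * r.den) = k := by
      refine ⟨q.num * r.den - r.num * q.den - ⌊q - r⌋ * (q.den * r.den), ?_⟩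
      rw [Int.fract]
      push_cast
      rw [← Rat.mul_den_eq_num q, ← Rat.mul_den_eq_num r]
      ring
    obtain ⟨k, hk⟩ := hint
    have hk0 : (0 : ℚ) < k := hk ▸ mul_pos hf hpos
    have hk1 : (1 : ℚ) ≤ k := by
      have : 0 < k := by exact_mod_cast hk0
      exact_mod_cast this
    have hle : (q.den * r.den : ℚ) ≤ Q ^ 2 := by
      rw [sq]
      exact_mod_cast Nat.mul_le_mul hqQ hrQ
    rw [inv_le_iff_one_le_mul₀ (hpos.trans_le hle)]
    calc (1 : ℚ) ≤ Int.fract (q - r) * (q.den * r.den) := hk ▸ hk1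
      _ ≤ _ := by gcongr
  have h := (Rat.cast_le (K := ℝ)).2 hQ
  rw [Rat.cast_fract] at h
  push_cast at h
  exact h

/-- Sums along `s` are sums over an interval after extending the coefficients by zero. -/
theorem sum_range_extend {M : Type*} [AddCommMonoid M] {T : ℕ} (γ : Fin T → ℂ) (s : Fin T → ℕ)
    (hs : Function.Injective s) (N : ℕ) (hN : ∀ n, s n < N) (g : ℕ → ℂ → M)
    (hg : ∀ m, g m 0 = 0) :
    ∑ m ∈ Finset.range N, g m (Function.extend s γ 0 m) = ∑ n, g (s n) (γ n) := by
  have h1 : ∑ m ∈ Finset.univ.image s, g m (Function.extend s γ 0 m) = ∑ n, g (s n) (γ n) := by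
    rw [Finset.sum_image fun a _ b _ h => hs h]
    exact Finset.sum_congr rfl fun n _ => by rw [hs.extend_apply]
  rw [← h1]
  symm
  refine Finset.sum_subset ?_ ?_
  · intro m hm
    obtain ⟨n, -, rfl⟩ := Finset.mem_image.1 hm
    exact Finset.mem_range.2 (hN n)
  · intro m _ hm
    rw [Function.extend_apply']
    · exact hg m
    · rintro ⟨n, rfl⟩; exact hm (Finset.mem_image_of_mem _ (Finset.mem_univ n))

/-- The large sieve for Farey fractions with denominators in `𝒟 ⊆ [1, Q]`, for the exponential
polynomial with coefficients `γ` and frequencies `s`. -/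
theorem large_sieve_redFracs {T : ℕ} (γ : Fin T → ℂ) (s : Fin T → ℕ) (hs : Function.Injective s)
    (N : ℕ) (hN : ∀ n, s n < N) (𝒟 : Finset ℕ) (Q : ℕ) (h𝒟 : ∀ d ∈ 𝒟, 0 < d ∧ d ≤ Q)
    (hQ : 0 < Q) :
    ∑ d ∈ 𝒟, ∑ q ∈ redFracs d, ‖∑ n, γ n * ec (q * s n)‖ ^ 2
      ≤ (N + (Q : ℝ) ^ 2 * (1 + Real.log ((Q : ℝ) ^ 2))) * ∑ n, ‖γ n‖ ^ 2 := by
  have hdisj : (𝒟 : Set ℕ).PairwiseDisjoint redFracs := by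
    intro d hd d' hd' hne
    rw [Function.onFun, Finset.disjoint_left]
    intro q hq hq'
    exact hne (((mem_redFracs (h𝒟 d hd).1).1 hq).2.2.symm.trans
      ((mem_redFracs (h𝒟 d' hd').1).1 hq').2.2)
  have hmem : ∀ q ∈ 𝒟.biUnion redFracs, 0 ≤ q ∧ q < 1 ∧ q.den ≤ Q := by
    intro q hq
    obtain ⟨d, hd, hqd⟩ := Finset.mem_biUnion.1 hq
    obtain ⟨h0, h1, h2⟩ := (mem_redFracs (h𝒟 d hd).1).1 hqd
    exact ⟨h0, h1, h2 ▸ (h𝒟 d hd).2⟩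
  have hQ1 : (1 : ℝ) ≤ (Q : ℝ) ^ 2 := one_le_pow₀ (by exact_mod_cast hQ)
  have hls := large_sieve (𝒟.biUnion redFracs) (fun q : ℚ => (q : ℝ)) ((Q : ℝ) ^ 2)⁻¹
    (by positivity) (inv_le_one_of_one_le₀ hQ1)
    (fun q hq r hr hne => by
      obtain ⟨a, b, c⟩ := hmem q hq
      obtain ⟨a', b', c'⟩ := hmem r hr
      exact one_div_le_fract_sub a b a' b' hne c c') N (Function.extend s γ 0)
  rw [Finset.sum_biUnion hdisj, inv_inv] at hls
  rw [sum_range_extend γ s hs N hN (fun _ z => ‖z‖ ^ 2) (by simp)] at hls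
  refine le_trans (le_of_eq ?_) hls
  refine Finset.sum_congr rfl fun d _ => Finset.sum_congr rfl fun q _ => ?_
  rw [sum_range_extend γ s hs N hN (fun m z => ec (m * q) * z) (by simp)]
  congr 2
  exact Finset.sum_congr rfl fun n _ => by rw [mul_comm, mul_comm (q : ℝ)]

/-! ### Fourier analysis of periodic functions -/

theorem sum_range_ec (n : ℕ) (hn : 0 < n) (k : ℤ) :
    ∑ y ∈ Finset.range n, ec (y * ((k : ℝ) / n)) = if (n : ℤ) ∣ k then (n : ℂ) else 0 := by
  have hn' : (n : ℝ) ≠ 0 := by exact_mod_cast hn.ne'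
  split_ifs with h
  · obtain ⟨j, rfl⟩ := h
    have : ∀ y : ℕ, ec (y * (((n * j : ℤ) : ℝ) / n)) = 1 := by
      intro y
      rw [show (y : ℝ) * (((n * j : ℤ) : ℝ) / n) = ((y * j : ℤ) : ℝ) by push_cast; field_simp]
      exact ec_intCast _
    rw [Finset.sum_congr rfl fun y _ => this y]
    simp
  · have hne : ec ((k : ℝ) / n) ≠ 1 := by
      rw [Ne, ec_eq_one_iff]
      rintro ⟨j, hj⟩
      rw [div_eq_iff hn'] at hj
      exact h ⟨j, by rw [mul_comm]; exact_mod_cast hj⟩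
    simp_rw [ec_nat_mul]
    rw [geom_sum_eq hne, ← ec_nat_mul, mul_div_cancel₀ _ hn', ec_intCast]
    simp

theorem sum_fracs_ec (n : ℕ) (hn : 0 < n) (k : ℤ) :
    ∑ q ∈ fracs n, ec (q * k) = if (n : ℤ) ∣ k then (n : ℂ) else 0 := by
  rw [sum_fracs hn (fun q : ℚ => ec (q * k)), ← sum_range_ec n hn k]
  refine Finset.sum_congr rfl fun y _ => ?_
  congr 1
  push_cast
  ring

/-- The Fourier coefficient at the frequency `q` of an `n`-periodic function on `ℕ`. -/
noncomputable def fcoeff (f : ℕ → ℂ) (n : ℕ) (q : ℚ) : ℂ :=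
  (1 / n : ℂ) * ∑ y ∈ Finset.range n, ec (-(q * y)) * f y

theorem sum_fcoeff_mul_ec {f : ℕ → ℂ} {n : ℕ} (hn : 0 < n) (hf : Function.Periodic f n) (x : ℕ) :
    ∑ q ∈ fracs n, fcoeff f n q * ec (q * x) = f x := by
  have hn' : (n : ℂ) ≠ 0 := by exact_mod_cast hn.ne'
  have h1 : ∑ q ∈ fracs n, fcoeff f n q * ec (q * x)
      = (1 / n : ℂ) * ∑ y ∈ Finset.range n, f y * ∑ q ∈ fracs n, ec (q * ((x - y : ℤ) : ℝ)) := by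
    simp_rw [fcoeff, Finset.mul_sum, Finset.sum_mul]
    rw [Finset.sum_comm]
    refine Finset.sum_congr rfl fun y _ => Finset.sum_congr rfl fun q _ => ?_
    rw [show (q : ℝ) * ((x - y : ℤ) : ℝ) = -(q * y) + q * x by push_cast; ring, ec_add]
    ring
  have h2 : ∀ y ∈ Finset.range n, f y * ∑ q ∈ fracs n, ec (q * ((x - y : ℤ) : ℝ))
      = if x % n = y then n * f x else 0 := by
    intro y hy
    have hyn := Finset.mem_range.1 hy
    rw [sum_fracs_ec n hn]
    have hiff : (n : ℤ) ∣ (x - y : ℤ) ↔ x % n = y := by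
      rw [← Nat.modEq_iff_dvd, Nat.ModEq, Nat.mod_eq_of_lt hyn, eq_comm]
    simp only [hiff]
    split_ifs with h
    · rw [← h, hf.map_mod_nat, mul_comm]
    · simp
  rw [h1, Finset.sum_congr rfl h2, Finset.sum_ite_eq, if_pos (Finset.mem_range.2 (Nat.mod_lt _ hn))]
  field_simp

/-- Bessel's inequality. -/
theorem sum_sq_norm_fcoeff_le {f : ℕ → ℂ} {n : ℕ} (hn : 0 < n) (hf : ∀ x, ‖f x‖ ≤ 1) :
    ∑ q ∈ fracs n, ‖fcoeff f n q‖ ^ 2 ≤ 1 := by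
  have hn' : (0 : ℝ) < n := by exact_mod_cast hn
  have h1 := sum_sq_norm_le_of_row_sum_le (Finset.range n) (Finset.range n)
    (fun b y => ec (-((b : ℝ) / n * y))) n hn'.le (fun b hb => by
      have : ∀ b' ∈ Finset.range n, ‖∑ y ∈ Finset.range n, ec (-((b : ℝ) / n * y)) *
          (starRingEnd ℂ) (ec (-((b' : ℝ) / n * y)))‖ = if b' = b then (n : ℝ) else 0 := by
        intro b' hb'
        have h2 : ∀ y : ℕ, ec (-((b : ℝ) / n * y)) * (starRingEnd ℂ) (ec (-((b' : ℝ) / n * y)))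
            = ec (y * (((b' - b : ℤ) : ℝ) / n)) := by
          intro y
          rw [conj_ec, ← ec_add]
          congr 1
          push_cast
          ring
        simp_rw [h2]
        rw [sum_range_ec n hn]
        have hb := Finset.mem_range.1 hb
        have hb' := Finset.mem_range.1 hb'
        have hiff : (n : ℤ) ∣ (b' - b : ℤ) ↔ b' = b := by
          rw [← Nat.modEq_iff_dvd, Nat.ModEq, Nat.mod_eq_of_lt hb, Nat.mod_eq_of_lt hb', eq_comm]
        simp only [hiff]
        split_ifs <;> simp
      rw [Finset.sum_congr rfl this, Finset.sum_ite_eq', if_pos hb]) f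
  have h3 : ∑ y ∈ Finset.range n, ‖f y‖ ^ 2 ≤ n := by
    calc ∑ y ∈ Finset.range n, ‖f y‖ ^ 2 ≤ ∑ y ∈ Finset.range n, (1 : ℝ) :=
          Finset.sum_le_sum fun y _ => pow_le_one₀ (norm_nonneg _) (hf y)
      _ = n := by simp
  rw [sum_fracs hn]
  simp_rw [fcoeff, norm_mul, mul_pow]
  rw [← Finset.mul_sum]
  have h4 : ‖(1 / n : ℂ)‖ ^ 2 = 1 / (n : ℝ) ^ 2 := by simp
  rw [h4, one_div, inv_mul_le_iff₀ (by positivity), mul_one]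
  refine le_trans (le_of_eq ?_) (h1.trans (by rw [sq]; gcongr))
  push_cast
  rfl

theorem sum_range_mul_eq {M : Type*} [AddCommMonoid M] (e m : ℕ) (h : ℕ → M) :
    ∑ y ∈ Finset.range (e * m), h y
      = ∑ w ∈ Finset.range m, ∑ y ∈ Finset.range e, h (y + e * w) := by
  induction m with
  | zero => simp
  | succ m ih =>
    rw [Nat.mul_succ, Finset.sum_range_add, ih, Finset.sum_range_succ]
    congr 1
    exact Finset.sum_congr rfl fun y _ => by rw [add_comm]

theorem periodic_sum_progression {f : ℕ → ℂ} {e m : ℕ} (hf : Function.Periodic f (e * m)) :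
    Function.Periodic (fun x => ∑ w ∈ Finset.range m, f (x + e * w)) e := by
  intro x
  have h1 := Finset.sum_range_succ (fun w => f (x + e * w)) m
  rw [Finset.sum_range_succ', mul_zero, add_zero, hf x] at h1
  have h2 := add_right_cancel h1
  refine Eq.trans ?_ h2
  refine Finset.sum_congr rfl fun w _ => ?_
  congr 1
  ring

/-- Frequencies in `fracs e` give functions of period `e`. -/
theorem exists_int_of_mem_fracs {e : ℕ} {q : ℚ} (hq : q ∈ fracs e) :
    ∃ k : ℤ, (q : ℝ) * e = k := by
  obtain ⟨b, hb, rfl⟩ := Finset.mem_image.1 hq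
  have he : (e : ℝ) ≠ 0 := by
    have := Finset.mem_range.1 hb
    exact_mod_cast (by omega : e ≠ 0)
  refine ⟨b, ?_⟩
  push_cast
  field_simp

/-- The part of the Fourier expansion of `f` on the frequencies of denominator dividing `e` is the
average of `f` over arithmetic progressions of difference `e`. -/
theorem sum_fcoeff_mul_ec_of_dvd {f : ℕ → ℂ} {e m : ℕ} (he : 0 < e) (hm : 0 < m)
    (hf : Function.Periodic f (e * m)) (x : ℕ) :
    ∑ q ∈ fracs e, fcoeff f (e * m) q * ec (q * x)
      = (1 / m : ℂ) * ∑ w ∈ Finset.range m, f (x + e * w) := by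
  set G : ℕ → ℂ := fun x => ∑ w ∈ Finset.range m, f (x + e * w) with hG
  have hm' : (m : ℂ) ≠ 0 := by exact_mod_cast hm.ne'
  have he' : (e : ℂ) ≠ 0 := by exact_mod_cast he.ne'
  have h1 : ∀ q ∈ fracs e, fcoeff f (e * m) q = (1 / m : ℂ) * fcoeff G e q := by
    intro q hq
    obtain ⟨k, hk⟩ := exists_int_of_mem_fracs hq
    rw [fcoeff, fcoeff, sum_range_mul_eq, Finset.sum_comm, ← mul_assoc]
    congr 1
    · push_cast; field_simp
    · refine Finset.sum_congr rfl fun y _ => ?_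
      rw [hG, Finset.mul_sum]
      refine Finset.sum_congr rfl fun w _ => ?_
      congr 1
      rw [show -((q : ℝ) * ((y + e * w : ℕ) : ℝ)) = -(q * y) + ((-(k * w) : ℤ) : ℝ) by
        push_cast; rw [← hk]; ring, ec_add, ec_intCast, mul_one]
  have h2 := sum_fcoeff_mul_ec he (periodic_sum_progression hf) x
  rw [← h2, Finset.mul_sum]
  exact Finset.sum_congr rfl fun q hq => by rw [h1 q hq, mul_assoc]

/-- Möbius inversion: a sum over fractions of exact denominator `d` is controlled by the sums over
all fractions with denominators dividing `d`. -/
theorem norm_sum_redFracs_le (h : ℚ → ℂ) {d : ℕ} (hd : 0 < d) :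
    ‖∑ q ∈ redFracs d, h q‖ ≤ ∑ e ∈ d.divisors, ‖∑ q ∈ fracs e, h q‖ := by
  have h1 := (ArithmeticFunction.sum_eq_iff_sum_mul_moebius_eq
    (f := fun d => ∑ q ∈ redFracs d, h q) (g := fun e => ∑ q ∈ fracs e, h q)).1
    (fun n hn => (sum_fracs_eq_sum_divisors hn h).symm) d hd
  rw [← h1]
  refine (norm_sum_le _ _).trans ?_
  rw [← Nat.sum_divisorsAntidiagonal' (f := fun _ e => ‖∑ q ∈ fracs e, h q‖)]
  refine Finset.sum_le_sum fun x _ => ?_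
  rw [norm_mul]
  refine mul_le_of_le_one_left (norm_nonneg _) ?_
  rw [Complex.norm_intCast]
  exact_mod_cast ArithmeticFunction.abs_moebius_le_one

/-- A sum of a periodic function `f` along a sequence `s`, split according to the denominators of
the frequencies of `f`: those below `D` are bounded through averages of `f` over progressions, the
others through the exponential polynomial attached to `s`. -/
theorem sq_norm_sum_le {f : ℕ → ℂ} {t : ℕ} (ht : 0 < t) (hf : Function.Periodic f t)
    (hf1 : ∀ x, ‖f x‖ ≤ 1) (D B : ℝ) (hB0 : 0 ≤ B)
    (hB : ∀ e m : ℕ, t = e * m → (e : ℝ) < D →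
      ∀ x, ‖∑ w ∈ Finset.range m, f (x + e * w)‖ ≤ m * B)
    {T : ℕ} (γ : Fin T → ℂ) (hγ : ∀ n, ‖γ n‖ ≤ 1) (s : Fin T → ℕ) :
    ‖∑ n, γ n * f (s n)‖ ^ 2 ≤ 2 * (T * (t.divisors.card : ℝ) ^ 2 * B) ^ 2
      + 2 * ∑ d ∈ t.divisors.filter (fun d : ℕ => D ≤ (d : ℝ)), ∑ q ∈ redFracs d, ‖∑ n, γ n * ec (q * s n)‖ ^ 2 := by
  set c := fcoeff f t with hc
  set W : ℚ → ℂ := fun q => ∑ n, γ n * ec (q * s n) with hW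
  set τ := t.divisors.card with hτ
  have hE : ∀ d ∈ t.divisors.filter (fun d : ℕ => ¬ D ≤ (d : ℝ)), ∀ x : ℕ,
      ‖∑ q ∈ redFracs d, c q * ec (q * x)‖ ≤ τ * B := by
    intro d hd x
    obtain ⟨hdt, hdD⟩ := Finset.mem_filter.1 hd
    obtain ⟨hdt, -⟩ := Nat.mem_divisors.1 hdt
    have hd0 := Nat.pos_of_dvd_of_pos hdt ht
    refine (norm_sum_redFracs_le _ hd0).trans ?_
    calc ∑ e ∈ d.divisors, ‖∑ q ∈ fracs e, c q * ec (q * x)‖ ≤ ∑ e ∈ d.divisors, B := by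
          refine Finset.sum_le_sum fun e he => ?_
          obtain ⟨hed, -⟩ := Nat.mem_divisors.1 he
          have he0 := Nat.pos_of_dvd_of_pos hed hd0
          obtain ⟨m, hm⟩ := hed.trans hdt
          have hm0 : 0 < m := Nat.pos_of_ne_zero fun h => by subst h; omega
          have hm0' : (0 : ℝ) < m := by exact_mod_cast hm0
          have heD : (e : ℝ) < D :=
            lt_of_le_of_lt (by exact_mod_cast Nat.le_of_dvd hd0 hed) (not_le.1 hdD)
          rw [hc, hm, sum_fcoeff_mul_ec_of_dvd he0 hm0 (hm ▸ hf), norm_mul]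
          have h1 : ‖(1 / m : ℂ)‖ = 1 / (m : ℝ) := by simp
          rw [h1, one_div, inv_mul_le_iff₀ hm0']
          exact hB e m hm heD x
      _ = d.divisors.card * B := by simp
      _ ≤ τ * B := by
          gcongr
          exact Finset.card_le_card (Nat.divisors_subset_of_dvd ht.ne' hdt)
  have hsplit : ∑ n, γ n * f (s n)
      = (∑ d ∈ t.divisors.filter (fun d : ℕ => ¬ D ≤ (d : ℝ)), ∑ n, γ n * ∑ q ∈ redFracs d, c q * ec (q * s n))
        + ∑ d ∈ t.divisors.filter (fun d : ℕ => D ≤ (d : ℝ)), ∑ q ∈ redFracs d, c q * W q := by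
    have h1 : ∀ d, ∑ q ∈ redFracs d, c q * W q
        = ∑ n, γ n * ∑ q ∈ redFracs d, c q * ec (q * s n) := by
      intro d
      simp_rw [hW, Finset.mul_sum]
      rw [Finset.sum_comm]
      exact Finset.sum_congr rfl fun _ _ => Finset.sum_congr rfl fun _ _ => by ring
    simp_rw [h1]
    rw [add_comm, Finset.sum_filter_add_sum_filter_not, Finset.sum_comm]
    refine Finset.sum_congr rfl fun n _ => ?_
    rw [← Finset.mul_sum, ← sum_fracs_eq_sum_divisors ht (fun q => c q * ec (q * s n)), hc,
      sum_fcoeff_mul_ec ht hf]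
  have hlow : ‖∑ d ∈ t.divisors.filter (fun d : ℕ => ¬ D ≤ (d : ℝ)),
      ∑ n, γ n * ∑ q ∈ redFracs d, c q * ec (q * s n)‖ ≤ T * (τ : ℝ) ^ 2 * B := by
    calc _ ≤ ∑ d ∈ t.divisors.filter (fun d : ℕ => ¬ D ≤ (d : ℝ)), ∑ n : Fin T, τ * B := by
          refine (norm_sum_le _ _).trans (Finset.sum_le_sum fun d hd =>
            (norm_sum_le _ _).trans (Finset.sum_le_sum fun n _ => ?_))
          rw [norm_mul]
          calc _ ≤ 1 * (τ * B) := by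
                gcongr
                · exact hγ n
                · exact hE d hd (s n)
            _ = τ * B := one_mul _
      _ = (t.divisors.filter fun d : ℕ => ¬ D ≤ (d : ℝ)).card * (T * (τ * B)) := by simp
      _ ≤ τ * (T * (τ * B)) := by
          gcongr
          exact Finset.card_filter_le _ _
      _ = _ := by ring
  have hhigh : ‖∑ d ∈ t.divisors.filter (fun d : ℕ => D ≤ (d : ℝ)), ∑ q ∈ redFracs d, c q * W q‖ ^ 2
      ≤ ∑ d ∈ t.divisors.filter (fun d : ℕ => D ≤ (d : ℝ)), ∑ q ∈ redFracs d, ‖W q‖ ^ 2 := by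
    rw [Finset.sum_sigma', Finset.sum_sigma']
    set A := (t.divisors.filter fun d : ℕ => D ≤ (d : ℝ)).sigma fun d => redFracs d with hA
    have hbes : ∑ z ∈ A, ‖c z.2‖ ^ 2 ≤ 1 := by
      rw [hA, ← Finset.sum_sigma' _ _ fun _ q => ‖c q‖ ^ 2]
      refine le_trans ?_ (sum_sq_norm_fcoeff_le ht hf1)
      rw [sum_fracs_eq_sum_divisors ht]
      exact Finset.sum_le_sum_of_subset_of_nonneg (Finset.filter_subset _ _)
        fun _ _ _ => Finset.sum_nonneg fun _ _ => sq_nonneg _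
    calc ‖∑ z ∈ A, c z.2 * W z.2‖ ^ 2 ≤ (∑ z ∈ A, ‖c z.2‖ * ‖W z.2‖) ^ 2 := by
          gcongr
          exact (norm_sum_le _ _).trans (Finset.sum_le_sum fun _ _ => (norm_mul _ _).le)
      _ ≤ (∑ z ∈ A, ‖c z.2‖ ^ 2) * ∑ z ∈ A, ‖W z.2‖ ^ 2 := Finset.sum_mul_sq_le_sq_mul_sq _ _ _
      _ ≤ 1 * ∑ z ∈ A, ‖W z.2‖ ^ 2 := by
          gcongr
      _ = _ := one_mul _
  rw [hsplit]
  have hsq : ∀ a b : ℂ, ‖a + b‖ ^ 2 ≤ 2 * ‖a‖ ^ 2 + 2 * ‖b‖ ^ 2 := by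
    intro a b
    have h1 := norm_add_le a b
    nlinarith [norm_nonneg (a + b), sq_nonneg (‖a‖ - ‖b‖)]
  refine (hsq _ _).trans ?_
  gcongr

/-! ### Sums over a single prime and sums over denominators -/

theorem e_eq_ec (p : ℕ) (z : ℤ) : e p z = ec ((z : ℝ) / p) := by
  rw [e, ec]
  push_cast
  ring_nf

theorem norm_e (p : ℕ) (z : ℤ) : ‖e p z‖ = 1 := by rw [e_eq_ec, norm_ec]

theorem e_congr {p : ℕ} (hp : 0 < p) {y z : ℤ} (h : (y : ZMod p) = z) : e p y = e p z := by
  obtain ⟨k, hk⟩ := (ZMod.intCast_eq_intCast_iff_dvd_sub _ _ _).1 h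
  have hz : z = y + p * k := by omega
  have hp' : (p : ℝ) ≠ 0 := by exact_mod_cast hp.ne'
  rw [e_eq_ec, e_eq_ec, hz, show (((y + p * k : ℤ) : ℝ)) / p = (y : ℝ) / p + k by
    push_cast; field_simp, ec_add, ec_intCast, mul_one]

theorem periodic_e {p : ℕ} (hp : 0 < p) (l a : ℤ) :
    Function.Periodic (fun x : ℕ => e p (a * l ^ x)) (ord l p) := by
  intro x
  refine e_congr hp ?_
  push_cast
  rw [pow_add, ord, pow_orderOf_eq_one, mul_one]

theorem isCoprime_of_ord_pos {p : ℕ} {l : ℤ} (h : 0 < ord l p) :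
    IsCoprime l (p : ℤ) := by
  have hu : IsUnit (l : ZMod p) := by
    refine IsUnit.of_mul_eq_one ((l : ZMod p) ^ (ord l p - 1)) ?_
    rw [← pow_succ', Nat.sub_add_cancel h, ord, pow_orderOf_eq_one]
  exact (ZMod.coe_int_isUnit_iff_isCoprime l p).1 hu |>.symm

theorem ord_dvd_sub_one {p : ℕ} (hp : p.Prime) {l : ℤ} (h : 0 < ord l p) : ord l p ∣ p - 1 := by
  have := Fact.mk hp
  refine orderOf_dvd_of_pow_eq_one (ZMod.pow_card_sub_one_eq_one ?_)
  intro h0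
  rw [ord, h0, orderOf_zero] at h
  exact lt_irrefl _ h

/-- The exponents bounding complete sums over the group generated by `l` also bound sums over
progressions in the exponent, which are complete sums over the subgroup generated by `l ^ e₀`. -/
theorem norm_sum_progression_le {α ρ : ℝ} {p : ℕ} (hp : 0 < p)
    (hadm : ∀ l : ℤ, IsCoprime l (p : ℤ) → ∀ a : ℤ, IsCoprime a (p : ℤ) →
      ‖∑ z ∈ Finset.Icc 1 (ord l p), e p (a * l ^ z)‖ ≤ (ord l p : ℝ) ^ α * (p : ℝ) ^ ρ)
    {l a : ℤ} (ha : IsCoprime a (p : ℤ)) {e₀ m : ℕ} (ht : ord l p = e₀ * m) (hpos : 0 < ord l p)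
    (x : ℕ) :
    ‖∑ w ∈ Finset.range m, e p (a * l ^ (x + e₀ * w))‖ ≤ (m : ℝ) ^ α * (p : ℝ) ^ ρ := by
  have hl := isCoprime_of_ord_pos hpos
  have he : 0 < e₀ := Nat.pos_of_ne_zero fun h => by subst h; omega
  have hord : ord (l ^ e₀) p = m := by
    have h1 : ord (l ^ e₀) p = ord l p / e₀ := by
      rw [ord]
      push_cast
      exact orderOf_pow_of_dvd he.ne' ⟨m, ht⟩
    rw [h1, ht, Nat.mul_div_cancel_left _ he]
  have h := hadm (l ^ e₀) hl.pow_left (a * l ^ x) (ha.mul_left hl.pow_left)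
  rw [hord] at h
  refine le_trans (le_of_eq ?_) h
  congr 1
  have hper : Function.Periodic (fun x : ℕ => e p (a * l ^ x)) (e₀ * m) := by
    rw [← ht]; exact periodic_e hp l a
  have h2 := periodic_sum_progression hper x
  simp only at h2
  rw [← h2, ← Finset.Ico_add_one_right_eq_Icc, Finset.sum_Ico_eq_sum_range]
  refine Finset.sum_congr rfl fun w _ => ?_
  congr 1
  ring

/-- The trivial group forces the second exponent of an admissible pair to be non-negative. -/
theorem Admissible.nonneg {α β : ℝ} (h : Admissible α β) : 0 ≤ β := by
  by_contra hneg
  push Not at hneg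
  obtain ⟨P, hP⟩ := h (-β / 2) (by linarith)
  obtain ⟨p, hpP, hp⟩ := Nat.exists_infinite_primes P
  have h1 := hP p hp hpP 1 isCoprime_one_left 1 isCoprime_one_left
  have hord : ord 1 p = 1 := by simp [ord]
  rw [hord] at h1
  simp only [Finset.Icc_self, Finset.sum_singleton, norm_e, Nat.cast_one, Real.one_rpow,
    one_mul] at h1
  have h2 : (p : ℝ) ^ (β + -β / 2) < 1 :=
    Real.rpow_lt_one_of_one_lt_of_neg (by exact_mod_cast hp.one_lt) (by linarith)
  linarith

/-- Each `d` divides `p - 1` for at most `X / d` primes `p ≤ X`. -/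
theorem sum_sum_divisors_le {X D : ℝ} (hX : 0 ≤ X) (A : Finset ℕ) (t : ℕ → ℕ)
    (hA : ∀ p ∈ A, 2 ≤ p ∧ (p : ℝ) ≤ X ∧ 0 < t p ∧ t p ∣ p - 1) (H : ℕ → ℝ) (hH : ∀ d, 0 ≤ H d) :
    ∑ p ∈ A, ∑ d ∈ (t p).divisors.filter (fun d : ℕ => D ≤ (d : ℝ)), H d
      ≤ X * ∑ d ∈ (Finset.Icc 1 ⌊X⌋₊).filter (fun d : ℕ => D ≤ (d : ℝ)), H d / d := by
  set 𝒟 := (Finset.Icc 1 ⌊X⌋₊).filter (fun d : ℕ => D ≤ (d : ℝ)) with h𝒟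
  have h1 : ∀ p ∈ A, ∑ d ∈ (t p).divisors.filter (fun d : ℕ => D ≤ (d : ℝ)), H d
      ≤ ∑ d ∈ 𝒟, if d ∣ t p then H d else 0 := by
    intro p hp
    obtain ⟨h2, hpX, ht0, htp⟩ := hA p hp
    rw [← Finset.sum_filter]
    refine Finset.sum_le_sum_of_subset_of_nonneg ?_ fun _ _ _ => hH _
    intro d hd
    obtain ⟨hd1, hd2⟩ := Finset.mem_filter.1 hd
    obtain ⟨hdt, -⟩ := Nat.mem_divisors.1 hd1
    have hdp : d ≤ p := (Nat.le_of_dvd (by omega) (hdt.trans htp)).trans (Nat.sub_le _ _)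
    refine Finset.mem_filter.2 ⟨Finset.mem_filter.2 ⟨Finset.mem_Icc.2
      ⟨Nat.pos_of_dvd_of_pos hdt ht0, Nat.le_floor (le_trans (by exact_mod_cast hdp) hpX)⟩, hd2⟩,
      hdt⟩
  refine (Finset.sum_le_sum h1).trans ?_
  rw [Finset.sum_comm, Finset.mul_sum]
  refine Finset.sum_le_sum fun d hd => ?_
  have hd0 : 0 < d := (Finset.mem_Icc.1 (Finset.mem_filter.1 hd).1).1
  rw [← Finset.sum_filter, Finset.sum_const, nsmul_eq_mul]
  have h3 := card_filter_dvd_sub_one_le X d hd0 (A.filter fun p => d ∣ t p) hX (fun p hp => by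
    obtain ⟨hpA, hdp⟩ := Finset.mem_filter.1 hp
    obtain ⟨h2, hpX, -, htp⟩ := hA p hpA
    exact ⟨h2, hpX, hdp.trans htp⟩)
  calc _ ≤ X / d * H d := mul_le_mul_of_nonneg_right h3 (hH d)
    _ = _ := by ring

/-- The contribution of denominators at least `D` to the large sieve, by dyadic decomposition. -/
theorem sum_redFracs_div_le {X D S : ℝ} (hX : 1 ≤ X) (hD : 0 < D) (hS : 0 ≤ S) {T : ℕ}
    (γ : Fin T → ℂ) (hγ : ∀ n, ‖γ n‖ ≤ 1) (s : Fin T → ℕ) (hs : Function.Injective s)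
    (hsS : ∀ n, (s n : ℝ) ≤ S) :
    ∑ d ∈ (Finset.Icc 1 ⌊X⌋₊).filter (fun d : ℕ => D ≤ (d : ℝ)),
        (∑ q ∈ redFracs d, ‖∑ n, γ n * ec (q * s n)‖ ^ 2) / d
      ≤ (Real.log X / Real.log 2 + 1) *
        (T * (2 * S / D + 1 + 4 * X * (1 + Real.log (4 * X ^ 2)))) := by
  set H : ℕ → ℝ := fun d => ∑ q ∈ redFracs d, ‖∑ n, γ n * ec (q * s n)‖ ^ 2 with hH
  have hH0 : ∀ d, 0 ≤ H d := fun d => Finset.sum_nonneg fun _ _ => sq_nonneg _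
  set 𝒟 := (Finset.Icc 1 ⌊X⌋₊).filter (fun d : ℕ => D ≤ (d : ℝ)) with h𝒟
  have hlog : 0 ≤ Real.log (4 * X ^ 2) := Real.log_nonneg (by nlinarith)
  have hsqγ : ∑ n, ‖γ n‖ ^ 2 ≤ T := by
    calc ∑ n, ‖γ n‖ ^ 2 ≤ ∑ n : Fin T, (1 : ℝ) :=
          Finset.sum_le_sum fun n _ => pow_le_one₀ (norm_nonneg _) (hγ n)
      _ = T := by simp
  set J := Nat.log 2 ⌊X⌋₊ + 1 with hJ
  have hJle : (J : ℝ) ≤ Real.log X / Real.log 2 + 1 := by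
    have hfl : 0 < ⌊X⌋₊ := Nat.floor_pos.2 hX
    have h1 : (2 : ℝ) ^ Nat.log 2 ⌊X⌋₊ ≤ X :=
      le_trans (by exact_mod_cast Nat.pow_log_le_self 2 hfl.ne') (Nat.floor_le (by linarith))
    have h2 := Real.log_le_log (by positivity) h1
    rw [Real.log_pow] at h2
    rw [hJ]
    push_cast
    rw [add_le_add_iff_right, le_div_iff₀ (Real.log_pos (by norm_num))]
    exact h2
  rw [← Finset.sum_fiberwise_of_maps_to (s := 𝒟) (t := Finset.range J) (g := Nat.log 2)
    fun d hd => Finset.mem_range.2 (Nat.lt_succ_of_le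
      (Nat.log_mono_right (Finset.mem_Icc.1 (Finset.mem_filter.1 hd).1).2))]
  set R := T * (2 * S / D + 1 + 4 * X * (1 + Real.log (4 * X ^ 2))) with hR
  have hR0 : 0 ≤ R := by positivity
  have hfib : ∀ j ∈ Finset.range J, ∑ d ∈ 𝒟.filter (fun d => Nat.log 2 d = j), H d / d ≤ R := by
    intro j _
    rcases (𝒟.filter (fun d => Nat.log 2 d = j)).eq_empty_or_nonempty with h0 | ⟨d₀, hd₀⟩
    · rw [h0, Finset.sum_empty]; exact hR0
    have hmem : ∀ d ∈ 𝒟.filter (fun d => Nat.log 2 d = j),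
        0 < d ∧ (d : ℝ) ≤ X ∧ D ≤ d ∧ 2 ^ j ≤ d ∧ d < 2 ^ (j + 1) := by
      intro d hd
      obtain ⟨hd1, rfl⟩ := Finset.mem_filter.1 hd
      obtain ⟨hd2, hdD⟩ := Finset.mem_filter.1 hd1
      obtain ⟨hd3, hdX⟩ := Finset.mem_Icc.1 hd2
      exact ⟨hd3, (Nat.le_floor_iff (by linarith)).1 hdX, hdD,
        Nat.pow_log_le_self 2 (by omega), Nat.lt_pow_succ_log_self (by norm_num) d⟩
    obtain ⟨hd0, hdX, hdD, hdj, hdj'⟩ := hmem d₀ hd₀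
    have hjX : (2 : ℝ) ^ j ≤ X := le_trans (by exact_mod_cast hdj) hdX
    have hjD : D ≤ 2 * (2 : ℝ) ^ j := by
      have : (d₀ : ℝ) ≤ 2 ^ (j + 1) := by exact_mod_cast hdj'.le
      rw [pow_succ] at this
      linarith
    have hj1 : (1 : ℝ) ≤ 2 ^ j := one_le_pow₀ (by norm_num)
    have hls := large_sieve_redFracs γ s hs (⌊S⌋₊ + 1)
      (fun n => Nat.lt_succ_of_le (Nat.le_floor (hsS n)))
      (𝒟.filter (fun d => Nat.log 2 d = j)) (2 ^ (j + 1))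
      (fun d hd => ⟨(hmem d hd).1, (hmem d hd).2.2.2.2.le⟩) (by positivity)
    have hsq : (((2 ^ (j + 1) : ℕ) : ℝ)) ^ 2 = 4 * ((2 : ℝ) ^ j) ^ 2 := by push_cast; ring
    rw [hsq] at hls
    have hlogj : Real.log (4 * ((2 : ℝ) ^ j) ^ 2) ≤ Real.log (4 * X ^ 2) :=
      Real.log_le_log (by positivity) (by gcongr)
    have hlogj0 : 0 ≤ Real.log (4 * ((2 : ℝ) ^ j) ^ 2) := Real.log_nonneg (by nlinarith)
    have hN : ((⌊S⌋₊ + 1 : ℕ) : ℝ) ≤ S + 1 := by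
      push_cast
      linarith [Nat.floor_le hS]
    calc ∑ d ∈ 𝒟.filter (fun d => Nat.log 2 d = j), H d / d
        ≤ ∑ d ∈ 𝒟.filter (fun d => Nat.log 2 d = j), H d / 2 ^ j := by
          refine Finset.sum_le_sum fun d hd => ?_
          have : (2 : ℝ) ^ j ≤ d := by exact_mod_cast (hmem d hd).2.2.2.1
          exact div_le_div_of_nonneg_left (hH0 d) (by positivity) this
      _ = (∑ d ∈ 𝒟.filter (fun d => Nat.log 2 d = j), H d) / 2 ^ j := by rw [Finset.sum_div]
      _ ≤ (((S + 1) + 4 * ((2 : ℝ) ^ j) ^ 2 * (1 + Real.log (4 * X ^ 2))) * T) / 2 ^ j := by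
          gcongr
          refine hls.trans ?_
          gcongr
      _ = T * (S / 2 ^ j + 1 / 2 ^ j + 4 * 2 ^ j * (1 + Real.log (4 * X ^ 2))) := by
          field_simp
      _ ≤ R := by
          have h1 : S / 2 ^ j ≤ 2 * S / D := by
            rw [div_le_div_iff₀ (by positivity) hD]
            nlinarith
          have h2 : (1 : ℝ) / 2 ^ j ≤ 1 := by rw [div_le_one (by positivity)]; exact hj1
          have h3 : 4 * (2 : ℝ) ^ j * (1 + Real.log (4 * X ^ 2))
              ≤ 4 * X * (1 + Real.log (4 * X ^ 2)) := by gcongr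
          exact mul_le_mul_of_nonneg_left (by linarith) (by positivity)
  calc _ ≤ ∑ j ∈ Finset.range J, R := Finset.sum_le_sum hfib
    _ = J * R := by simp
    _ ≤ _ := by gcongr

/-! ### The large sieve for exponential sequences -/

/-- The cut-off for denominators balances the large sieve term `S / D` against the term
`T * D ^ (2 - 2α) * X ^ (-2η)` coming from admissibility. -/
theorem balance_cutoff {α η S T X D : ℝ} (hα : α < 1) (hS : 0 < S) (hT : 0 < T) (hX : 0 < X)
    (hD : D = (S * X ^ (2 * η) / T) ^ (1 / (3 - 2 * α))) :
    T * (D ^ (1 - α) * X ^ (-η)) ^ 2 = S / D ∧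
      (S ^ (2 - 2 * α) * T * X ^ (-(2 * η))) ^ (1 / (3 - 2 * α)) = S / D := by
  have hu : 0 < 3 - 2 * α := by linarith
  have hbase : 0 < S * X ^ (2 * η) / T := by positivity
  have hD0 : 0 < D := by rw [hD]; positivity
  have hDu : D ^ (3 - 2 * α) = S * X ^ (2 * η) / T := by
    rw [hD, ← Real.rpow_mul hbase.le, one_div_mul_cancel hu.ne', Real.rpow_one]
  have hXX : X ^ (2 * η) * X ^ (-(2 * η)) = 1 := by
    rw [← Real.rpow_add hX, add_neg_cancel, Real.rpow_zero]
  have hD2 : D ^ (2 - 2 * α) * D = D ^ (3 - 2 * α) := by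
    conv_lhs => rw [← Real.rpow_add_one hD0.ne']
    congr 1
    ring
  have hS2 : S ^ (2 - 2 * α) * S = S ^ (3 - 2 * α) := by
    conv_lhs => rw [← Real.rpow_add_one hS.ne']
    congr 1
    ring
  constructor
  · rw [mul_pow, ← Real.rpow_mul_natCast hD0.le, ← Real.rpow_mul_natCast hX.le,
      eq_div_iff hD0.ne']
    rw [show (1 - α) * (2 : ℕ) = 2 - 2 * α by push_cast; ring,
      show -η * (2 : ℕ) = -(2 * η) by push_cast; ring]
    calc _ = T * (D ^ (2 - 2 * α) * D) * X ^ (-(2 * η)) := by ring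
      _ = S * (X ^ (2 * η) * X ^ (-(2 * η))) := by
          rw [hD2, hDu]; field_simp
      _ = S := by rw [hXX, mul_one]
  · have h1 : S ^ (2 - 2 * α) * T * X ^ (-(2 * η)) = (S / D) ^ (3 - 2 * α) := by
      rw [Real.div_rpow hS.le hD0.le, hDu, ← hS2, eq_div_iff hbase.ne']
      calc _ = S ^ (2 - 2 * α) * S * (X ^ (2 * η) * X ^ (-(2 * η))) := by field_simp
        _ = _ := by rw [hXX, mul_one]
    rw [h1, ← Real.rpow_mul (by positivity), mul_one_div_cancel hu.ne', Real.rpow_one]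

/-- The logarithmic factors of the large sieve are `X ^ o(1)`. -/
theorem exists_log_mul_log_le (ε : ℝ) (hε : 0 < ε) :
    ∃ K : ℝ, 0 ≤ K ∧ ∀ X : ℝ, 1 ≤ X →
      (Real.log X / Real.log 2 + 1) * (1 + Real.log (4 * X ^ 2)) ≤ K * X ^ ε := by
  have hlog2 : 0 < Real.log 2 := Real.log_pos (by norm_num)
  have hlog4 : 0 < Real.log 4 := Real.log_pos (by norm_num)
  refine ⟨(1 / (ε / 2) / Real.log 2 + 1) * (1 + Real.log 4 + 2 * (1 / (ε / 2))), by positivity,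
    fun X hX => ?_⟩
  have hX0 : 0 < X := by linarith
  have h1 : 1 ≤ X ^ (ε / 2) := Real.one_le_rpow hX (by positivity)
  have h2 : Real.log X ≤ 1 / (ε / 2) * X ^ (ε / 2) := by
    have := Real.log_le_rpow_div hX0.le (half_pos hε)
    linarith [this, show X ^ (ε / 2) / (ε / 2) = 1 / (ε / 2) * X ^ (ε / 2) by ring]
  have h0 : 0 ≤ Real.log X := Real.log_nonneg hX
  have h3 : Real.log (4 * X ^ 2) = Real.log 4 + 2 * Real.log X := by
    rw [Real.log_mul (by norm_num) (by positivity), Real.log_pow]; push_cast; ring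
  have h4 : X ^ ε = X ^ (ε / 2) * X ^ (ε / 2) := by rw [← Real.rpow_add hX0]; ring_nf
  rw [h3, h4]
  calc _ ≤ (1 / (ε / 2) * X ^ (ε / 2) / Real.log 2 + X ^ (ε / 2)) *
        (X ^ (ε / 2) + Real.log 4 * X ^ (ε / 2) + 2 * (1 / (ε / 2) * X ^ (ε / 2))) := by
        have h5 : Real.log 4 * 1 ≤ Real.log 4 * X ^ (ε / 2) := by gcongr
        have h6 : Real.log X / Real.log 2 ≤ 1 / (ε / 2) * X ^ (ε / 2) / Real.log 2 := by gcongr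
        exact mul_le_mul (by linarith) (by linarith) (by positivity) (by positivity)
    _ = _ := by ring

theorem mem_primeSet {l : ℤ} {X Δ : ℝ} {p : ℕ} (hX : 0 ≤ X) :
    p ∈ primeSet l X Δ ↔ p.Prime ∧ (p : ℝ) ≤ X ∧ Δ ≤ (ord l p : ℝ) := by
  unfold primeSet
  rw [Finset.mem_filter, Finset.mem_Icc, Nat.le_floor_iff hX]
  constructor
  · rintro ⟨⟨-, h1⟩, h2, h3⟩; exact ⟨h2, h1, h3⟩
  · rintro ⟨h1, h2, h3⟩; exact ⟨⟨h1.one_le, h2⟩, h1, h3⟩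

/-- The bound for a single prime `p ≤ X` modulo which the order of `l` is at least
`X ^ (1 / 2 - δ)`. -/
theorem sq_norm_expSum_le {α β η δ ε C X D : ℝ} (hα : α < 1) (hβ : 0 ≤ β)
    (hδ : (β + η) / (1 - α) ≤ 1 / 2 - δ) (hε : 0 < ε)
    (hC : ∀ n : ℕ, n ≠ 0 → (n.divisors.card : ℝ) ≤ C * (n : ℝ) ^ ε) (hC0 : 0 ≤ C)
    (hX : 1 ≤ X) (hD : 0 < D) {p : ℕ} (hp : p.Prime) (hpX : (p : ℝ) ≤ X)
    (hadm : ∀ l : ℤ, IsCoprime l (p : ℤ) → ∀ a : ℤ, IsCoprime a (p : ℤ) →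
      ‖∑ z ∈ Finset.Icc 1 (ord l p), e p (a * l ^ z)‖ ≤ (ord l p : ℝ) ^ α * (p : ℝ) ^ (β + ε))
    {l a : ℤ} (ha : IsCoprime a (p : ℤ)) (hord : 0 < ord l p)
    (hY : X ^ (1 / 2 - δ) ≤ (ord l p : ℝ))
    {T : ℕ} (γ : Fin T → ℂ) (hγ : ∀ n, ‖γ n‖ ≤ 1) (s : Fin T → ℕ) :
    ‖∑ n, γ n * e p (a * l ^ s n)‖ ^ 2
      ≤ 2 * C ^ 4 * X ^ (6 * ε) * (T * (T * (D ^ (1 - α) * X ^ (-η)) ^ 2))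
        + 2 * ∑ d ∈ (ord l p).divisors.filter (fun d : ℕ => D ≤ (d : ℝ)),
          ∑ q ∈ redFracs d, ‖∑ n, γ n * ec (q * s n)‖ ^ 2 := by
  set t := ord l p with ht
  have hX0 : 0 < X := by linarith
  have hp0 : (0 : ℝ) < p := by exact_mod_cast hp.pos
  have htX : (t : ℝ) ≤ X := by
    refine le_trans ?_ hpX
    have h1 := Nat.le_of_dvd (Nat.sub_pos_of_lt hp.one_lt) (ord_dvd_sub_one hp hord)
    exact_mod_cast h1.trans (Nat.sub_le _ _)
  have h1 := sq_norm_sum_le hord (periodic_e hp.pos l a) (fun x => (norm_e _ _).le) D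
    (D ^ (1 - α) * X ^ (-η) * X ^ ε) (by positivity) (fun e₀ m htm hlt x => by
      have hm0 : 0 < m := Nat.pos_of_ne_zero fun h => by subst h; omega
      have hm0' : (0 : ℝ) < m := by exact_mod_cast hm0
      have h2 := norm_sum_progression_le hp.pos hadm ha htm hord x
      refine h2.trans ?_
      have hmlow : X ^ (1 / 2 - δ) / D ≤ m := by
        rw [div_le_iff₀ hD]
        calc X ^ (1 / 2 - δ) ≤ (t : ℝ) := hY
          _ = m * e₀ := by rw [htm]; push_cast; ring
          _ ≤ m * D := by gcongr
      have hmα : (m : ℝ) ^ (α - 1) ≤ D ^ (1 - α) * X ^ (-(β + η)) := by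
        calc (m : ℝ) ^ (α - 1) ≤ (X ^ (1 / 2 - δ) / D) ^ (α - 1) :=
              Real.rpow_le_rpow_of_nonpos (by positivity) hmlow (by linarith)
          _ = D ^ (1 - α) * X ^ ((1 / 2 - δ) * (α - 1)) := by
              rw [Real.div_rpow (by positivity) hD.le, ← Real.rpow_mul hX0.le,
                show α - 1 = -(1 - α) by ring, Real.rpow_neg hD.le, div_inv_eq_mul, mul_comm]
          _ ≤ _ := by
              gcongr
              rw [div_le_iff₀ (by linarith)] at hδ
              linarith
      calc (m : ℝ) ^ α * (p : ℝ) ^ (β + ε) = m * (m : ℝ) ^ (α - 1) * (p : ℝ) ^ (β + ε) := by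
            rw [Real.rpow_sub_one hm0'.ne']; field_simp
        _ ≤ m * (D ^ (1 - α) * X ^ (-(β + η))) * X ^ (β + ε) := by gcongr
        _ = m * (D ^ (1 - α) * (X ^ (-(β + η)) * X ^ (β + ε))) := by ring
        _ = m * (D ^ (1 - α) * X ^ (-η) * X ^ ε) := by
            rw [← Real.rpow_add hX0, mul_assoc (D ^ (1 - α)), ← Real.rpow_add hX0]
            ring_nf) γ hγ s
  refine h1.trans ?_
  rw [add_le_add_iff_right]
  have hτ : (t.divisors.card : ℝ) ≤ C * X ^ ε := (hC t hord.ne').trans (by gcongr)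
  calc 2 * (T * (t.divisors.card : ℝ) ^ 2 * (D ^ (1 - α) * X ^ (-η) * X ^ ε)) ^ 2
      ≤ 2 * (T * (C * X ^ ε) ^ 2 * (D ^ (1 - α) * X ^ (-η) * X ^ ε)) ^ 2 := by gcongr
    _ = 2 * C ^ 4 * (X ^ ε) ^ 6 * (T * (T * (D ^ (1 - α) * X ^ (-η)) ^ 2)) := by ring
    _ = _ := by
      rw [← Real.rpow_mul_natCast hX0.le]
      push_cast
      rw [mul_comm ε 6]

/-- The bound for `V`, with `X ^ o(1)` made explicit. -/
theorem V_le {l : ℤ} (hl : 2 ≤ l) {α β η δ : ℝ} (hα : α < 1) (hadm : Admissible α β)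
    (hη : 0 < η) (hδ0 : 0 < δ) (hδ : (β + η) / (1 - α) ≤ 1 / 2 - δ) (ε : ℝ) (hε : 0 < ε) :
    ∃ K : ℝ, ∀ (X S Δ : ℝ) (T k : ℕ), 1 ≤ X → 0 < S → 1 < Δ →
      ∀ (γ : Fin T → ℂ) (s : Fin T → ℕ), (∀ n, ‖γ n‖ ≤ 1) → StrictMono s →
        (∀ n, (s n : ℝ) ≤ S) →
        V l γ s X Δ ≤ K * X ^ (6 * ε) * (boundFactor α η δ T S X k * T * X) := by
  obtain ⟨P, hP⟩ := hadm ε hε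
  obtain ⟨C, hC1, hC⟩ := exists_card_divisors_le_rpow ε hε
  obtain ⟨L, hL0, hL⟩ := exists_log_mul_log_le (6 * ε) (by positivity)
  have hβ := hadm.nonneg
  have hδhalf : 0 ≤ 1 / 2 - δ := le_trans (div_nonneg (by linarith) (by linarith)) hδ
  have hl' : (2 : ℝ) ≤ l := by exact_mod_cast hl
  refine ⟨P + l + 2 * C ^ 4 + 10 * L, fun X S Δ T k hX hS hΔ γ s hγ hs hsS => ?_⟩
  have hX0 : 0 < X := by linarith
  rcases Nat.eq_zero_or_pos T with rfl | hT
  · simp [V]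
  have hT' : (0 : ℝ) < T := by exact_mod_cast hT
  -- `D` may be below `1`; every denominator is then at least `D`
  set D := (S * X ^ (2 * η) / T) ^ (1 / (3 - 2 * α)) with hD
  have hD0 : 0 < D := by positivity
  obtain ⟨hbal, hthird⟩ := balance_cutoff hα hS hT' hX0 hD
  set E := primeSet l X Δ with hE
  have hmem : ∀ p ∈ E, p.Prime ∧ (p : ℝ) ≤ X ∧ 0 < ord l p := by
    intro p hp
    obtain ⟨h1, h2, h3⟩ := (mem_primeSet hX0.le).1 hp
    refine ⟨h1, h2, ?_⟩
    have : (0 : ℝ) < ord l p := by linarith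
    exact_mod_cast this
  have hEcard : (E.card : ℝ) ≤ X := by
    have h1 := card_filter_dvd_sub_one_le X 1 one_pos E hX0.le
      fun p hp => ⟨(hmem p hp).1.two_le, (hmem p hp).2.1, one_dvd _⟩
    simpa using h1
  set bad := E.filter fun p => p < P ∨ (ord l p : ℝ) < X ^ (1 / 2 - δ) with hbad
  have hbadcard : (bad.card : ℝ) ≤ P + l * X ^ (1 - 2 * δ) := by
    have h1 : bad ⊆ Finset.range P ∪ E.filter fun p => (ord l p : ℝ) < X ^ (1 / 2 - δ) := by
      intro p hp
      obtain ⟨hpE, h | h⟩ := Finset.mem_filter.1 hp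
      · exact Finset.mem_union_left _ (Finset.mem_range.2 h)
      · exact Finset.mem_union_right _ (Finset.mem_filter.2 ⟨hpE, h⟩)
    have h2 := (Finset.card_le_card h1).trans (Finset.card_union_le _ _)
    rw [Finset.card_range] at h2
    have h3 := card_primes_ord_le hl (E.filter fun p => (ord l p : ℝ) < X ^ (1 / 2 - δ))
      (X ^ (1 / 2 - δ)) (by positivity) fun p hp => by
        obtain ⟨hpE, h⟩ := Finset.mem_filter.1 hp
        exact ⟨(hmem p hpE).1, (hmem p hpE).2.2, h.le⟩
    rw [← Real.rpow_mul_natCast hX0.le, show (1 / 2 - δ) * (2 : ℕ) = 1 - 2 * δ by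
      push_cast; ring] at h3
    calc (bad.card : ℝ) ≤ ((P + _ : ℕ) : ℝ) := by exact_mod_cast h2
      _ ≤ _ := by push_cast; gcongr
  set H : ℕ → ℝ := fun d => ∑ q ∈ redFracs d, ‖∑ n, γ n * ec (q * s n)‖ ^ 2 with hH
  have hH0 : ∀ d, 0 ≤ H d := fun d => Finset.sum_nonneg fun _ _ => sq_nonneg _
  set M := 2 * C ^ 4 * X ^ (6 * ε) * (T * (S / D)) with hM
  have hM0 : 0 ≤ M := by positivity
  have hterm : ∀ p ∈ E,
      ⨆ a : {a : ℤ // IsCoprime a (p : ℤ)}, ‖∑ n : Fin T, γ n * e p ((a : ℤ) * l ^ s n)‖ ^ 2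
      ≤ (if p < P ∨ (ord l p : ℝ) < X ^ (1 / 2 - δ) then (T : ℝ) ^ 2 else 0) + M
        + 2 * ∑ d ∈ (ord l p).divisors.filter (fun d : ℕ => D ≤ (d : ℝ)), H d := by
    intro p hp
    obtain ⟨hpp, hpX, hpo⟩ := hmem p hp
    have : Nonempty {a : ℤ // IsCoprime a (p : ℤ)} := ⟨⟨1, isCoprime_one_left⟩⟩
    have hsum0 : 0 ≤ ∑ d ∈ (ord l p).divisors.filter (fun d : ℕ => D ≤ (d : ℝ)), H d :=
      Finset.sum_nonneg fun _ _ => hH0 _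
    refine ciSup_le fun ⟨a, ha⟩ => ?_
    split_ifs with h
    · have h1 : ‖∑ n : Fin T, γ n * e p (a * l ^ s n)‖ ≤ T := by
        calc _ ≤ ∑ n : Fin T, ‖γ n * e p (a * l ^ s n)‖ := norm_sum_le _ _
          _ ≤ ∑ n : Fin T, (1 : ℝ) := Finset.sum_le_sum fun n _ => by
              rw [norm_mul, norm_e, mul_one]; exact hγ n
          _ = T := by simp
      have h2 : ‖∑ n : Fin T, γ n * e p (a * l ^ s n)‖ ^ 2 ≤ (T : ℝ) ^ 2 := by gcongr
      linarith
    · push Not at h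
      have h1 := sq_norm_expSum_le hα hβ hδ hε hC (by linarith) hX hD0 hpp hpX
        (hP p hpp h.1) ha hpo h.2 γ hγ s
      rw [hbal] at h1
      linarith
  have hhigh : ∑ p ∈ E, ∑ d ∈ (ord l p).divisors.filter (fun d : ℕ => D ≤ (d : ℝ)), H d
      ≤ 5 * L * X ^ (6 * ε) * (T * X * (X + S / D)) := by
    have h1 := sum_sum_divisors_le (D := D) hX0.le E (fun p => ord l p) (fun p hp => by
      obtain ⟨hpp, hpX, hpo⟩ := hmem p hp
      exact ⟨hpp.two_le, hpX, hpo, ord_dvd_sub_one hpp hpo⟩) H hH0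
    have h2 := sum_redFracs_div_le hX hD0 hS.le γ hγ s hs.injective hsS
    refine h1.trans ?_
    have hl1 : 0 ≤ Real.log X / Real.log 2 + 1 := by
      have := Real.log_nonneg hX
      have := Real.log_pos (one_lt_two)
      positivity
    set L₂ := 1 + Real.log (4 * X ^ 2) with hL₂
    have hL₂1 : 1 ≤ L₂ := by
      have : 0 ≤ Real.log (4 * X ^ 2) := Real.log_nonneg (by nlinarith)
      linarith
    have hSD : 0 < S / D := by positivity
    calc _ ≤ X * ((Real.log X / Real.log 2 + 1) *
          (T * (2 * S / D + 1 + 4 * X * L₂))) := by gcongr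
      _ ≤ X * ((Real.log X / Real.log 2 + 1) * (T * (5 * L₂ * (X + S / D)))) := by
          gcongr
          rw [mul_div_assoc]
          nlinarith [mul_nonneg (sub_nonneg.2 hL₂1) hSD.le, mul_nonneg (sub_nonneg.2 hL₂1) hX0.le]
      _ = 5 * ((Real.log X / Real.log 2 + 1) * L₂) * (T * X * (X + S / D)) := by ring
      _ ≤ 5 * (L * X ^ (6 * ε)) * (T * X * (X + S / D)) := by
          exact mul_le_mul_of_nonneg_right (mul_le_mul_of_nonneg_left (hL X hX) (by norm_num))
            (by positivity)
      _ = _ := by ring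
  have hδk : X ^ (1 - 2 * δ) ≤ X * X ^ (-δ / ((k : ℝ) ^ 2 + 2)) := by
    rw [← Real.rpow_one_add' hX0.le]
    · refine Real.rpow_le_rpow_of_exponent_le hX ?_
      have : δ / ((k : ℝ) ^ 2 + 2) ≤ 2 * δ := by
        rw [div_le_iff₀ (by positivity)]
        nlinarith [mul_nonneg hδ0.le (sq_nonneg (k : ℝ))]
      rw [neg_div]
      linarith
    · have : δ / ((k : ℝ) ^ 2 + 2) < 1 := by
        rw [div_lt_one (by positivity)]
        nlinarith [sq_nonneg (k : ℝ)]
      rw [neg_div]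
      linarith
  have hXδ1 : 1 ≤ X ^ (1 - 2 * δ) := Real.one_le_rpow hX (by linarith)
  set U := X ^ (-δ / ((k : ℝ) ^ 2 + 2)) with hU
  have hXε : 1 ≤ X ^ (6 * ε) := Real.one_le_rpow hX (by positivity)
  have hbf : boundFactor α η δ T S X k = X + T * U + S / D := by
    rw [boundFactor, hthird]
  rw [hbf]
  have hSD : 0 < S / D := by positivity
  have hU0 : 0 < U := by positivity
  calc V l γ s X Δ
      ≤ ∑ p ∈ E, ((if p < P ∨ (ord l p : ℝ) < X ^ (1 / 2 - δ) then (T : ℝ) ^ 2 else 0) + M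
        + 2 * ∑ d ∈ (ord l p).divisors.filter (fun d : ℕ => D ≤ (d : ℝ)), H d) :=
        Finset.sum_le_sum hterm
    _ = bad.card * (T : ℝ) ^ 2 + E.card * M
        + 2 * ∑ p ∈ E, ∑ d ∈ (ord l p).divisors.filter (fun d : ℕ => D ≤ (d : ℝ)), H d := by
        rw [Finset.sum_add_distrib, Finset.sum_add_distrib, ← Finset.sum_filter,
          Finset.sum_const, Finset.sum_const, nsmul_eq_mul, nsmul_eq_mul, ← Finset.mul_sum]
    _ ≤ ((P + l) * (X * U)) * (T : ℝ) ^ 2 + X * M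
        + 2 * (5 * L * X ^ (6 * ε) * (T * X * (X + S / D))) := by
        gcongr
        calc (bad.card : ℝ) ≤ P + l * X ^ (1 - 2 * δ) := hbadcard
          _ ≤ P * X ^ (1 - 2 * δ) + l * X ^ (1 - 2 * δ) := by
              gcongr
              exact le_mul_of_one_le_right (by positivity) hXδ1
          _ = (P + l) * X ^ (1 - 2 * δ) := by ring
          _ ≤ _ := by gcongr
    _ = (P + l) * 1 * ((T * U) * T * X) + 2 * C ^ 4 * X ^ (6 * ε) * ((S / D) * T * X)
        + 10 * L * X ^ (6 * ε) * ((X + S / D) * T * X) := by rw [hM]; ring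
    _ ≤ (P + l) * X ^ (6 * ε) * ((X + T * U + S / D) * T * X)
        + 2 * C ^ 4 * X ^ (6 * ε) * ((X + T * U + S / D) * T * X)
        + 10 * L * X ^ (6 * ε) * ((X + T * U + S / D) * T * X) := by
        have hTU : 0 < T * U := by positivity
        have hmono : ∀ y, y ≤ X + T * U + S / D → y * T * X ≤ (X + T * U + S / D) * T * X :=
          fun y hy => by gcongr
        refine add_le_add (add_le_add ?_ ?_) ?_
        · exact mul_le_mul (mul_le_mul_of_nonneg_left hXε (by positivity))
            (hmono _ (by linarith)) (by positivity) (by positivity)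
        · exact mul_le_mul_of_nonneg_left (hmono _ (by linarith)) (by positivity)
        · exact mul_le_mul_of_nonneg_left (hmono _ (by linarith)) (by positivity)
    _ = _ := by ring

/-! ### Power savings -/

/-- The power saving follows from linear inequalities between the exponents, read off at the extreme
values `T = X ^ (1 + ε)` and `S = X ^ (θ - ε)`. -/
theorem powerSaving_of_exponents {α β θ ε η δ c₀ : ℝ} (hα : α < 1) (hε : 0 < ε) (hη : 0 < η)
    (hδ : 0 < δ) (hc₀ : 0 < c₀) (h1 : (β + η) / (1 - α) ≤ 1 / 2 - δ)
    (h2 : θ - ε + 2 * η ≤ (1 + ε) * (1 + 1 / (3 - 2 * α)))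
    (h3 : 0 < (1 + ε - (θ - ε) - 2 * η) / (3 - 2 * α) + 1 / 2)
    (h4 : (2 - 2 * α) * (θ - ε) - 2 * η + c₀ * (3 - 2 * α) ≤ (2 - 2 * α) * (1 + ε)) :
    PowerSaving α β θ ε := by
  set κ := (1 + ε - (θ - ε) - 2 * η) / (3 - 2 * α) + 1 / 2 with hκ
  have hu : 0 < 3 - 2 * α := by linarith
  set k := ⌈1 / κ⌉₊ with hk
  have hk1 : 1 ≤ k := Nat.ceil_pos.2 (by positivity)
  have hκk : 1 ≤ κ * k := by
    have := Nat.le_ceil (1 / κ)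
    rwa [div_le_iff₀' h3] at this
  set δ' := δ / ((k : ℝ) ^ 2 + 2) with hδ'
  have hδ'0 : 0 < δ' := by positivity
  set c := min ε (min δ' c₀) / 2 with hc
  have hc0 : 0 < c := half_pos (lt_min hε (lt_min hδ'0 hc₀))
  have hcε : 2 * c ≤ ε := by rw [hc, mul_div_cancel₀ _ two_ne_zero]; exact min_le_left _ _
  have hcδ : 2 * c ≤ δ' := by
    rw [hc, mul_div_cancel₀ _ two_ne_zero]; exact (min_le_right _ _).trans (min_le_left _ _)
  have hcc : 2 * c ≤ c₀ := by
    rw [hc, mul_div_cancel₀ _ two_ne_zero]; exact (min_le_right _ _).trans (min_le_right _ _)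
  refine ⟨η, δ, c, 3 ^ (1 / c), k, hη, hδ, hc0, hk1, h1, fun X S T hX hS hT hSX => ?_⟩
  have hX1 : 1 ≤ X := (Real.one_le_rpow (by norm_num) (by positivity)).trans hX
  have hX0 : 0 < X := by linarith
  have hXc : 3 ≤ X ^ c := by
    calc (3 : ℝ) = (3 ^ (1 / c)) ^ c := by
          rw [← Real.rpow_mul (by norm_num), one_div_mul_cancel hc0.ne', Real.rpow_one]
      _ ≤ X ^ c := by gcongr
  have hT0 : (0 : ℝ) < T := lt_of_lt_of_le (by positivity) hT
  have hmono : ∀ {a b : ℝ}, a ≤ b → X ^ a ≤ X ^ b :=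
    fun h => Real.rpow_le_rpow_of_exponent_le hX1 h
  have hSη : S * X ^ (2 * η) ≤ X ^ (θ - ε + 2 * η) := by
    rw [Real.rpow_add hX0]; gcongr
  refine ⟨⟨?_, ?_⟩, ?_⟩
  · calc S * X ^ (2 * η) ≤ X ^ (θ - ε + 2 * η) := hSη
      _ ≤ X ^ ((1 + ε) * (1 + 1 / (3 - 2 * α))) := hmono h2
      _ = (X ^ (1 + ε)) ^ (1 + 1 / (3 - 2 * α)) := Real.rpow_mul hX0.le _ _
      _ ≤ _ := by gcongr
  · have hbase : X ^ (1 + ε - (θ - ε) - 2 * η) ≤ T / (S * X ^ (2 * η)) := by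
      rw [sub_sub, Real.rpow_sub hX0]
      gcongr
    calc X = X ^ (1 : ℝ) := (Real.rpow_one X).symm
      _ ≤ X ^ (κ * k) := hmono hκk
      _ = (X ^ κ) ^ k := Real.rpow_mul_natCast hX0.le _ _
      _ = ((X ^ (1 + ε - (θ - ε) - 2 * η)) ^ (1 / (3 - 2 * α)) * X ^ (1 / 2 : ℝ)) ^ k := by
          rw [← Real.rpow_mul hX0.le, ← Real.rpow_add hX0, hκ, mul_one_div]
      _ ≤ _ := by gcongr
  · have hfirst : X ≤ X ^ (-(2 * c)) * T := by
      calc X = X ^ (-ε) * X ^ (1 + ε) := by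
            rw [← Real.rpow_add hX0, show -ε + (1 + ε) = 1 by ring, Real.rpow_one]
        _ ≤ X ^ (-(2 * c)) * T := by
            gcongr
    have hsecond : T * X ^ (-δ / ((k : ℝ) ^ 2 + 2)) ≤ X ^ (-(2 * c)) * T := by
      rw [mul_comm]
      gcongr
      rw [neg_div, ← hδ']
      linarith
    have hthird : (S ^ (2 - 2 * α) * T * X ^ (-(2 * η))) ^ (1 / (3 - 2 * α))
        ≤ X ^ (-(2 * c)) * T := by
      have ha : 0 < 2 - 2 * α := by linarith
      rw [one_div, Real.rpow_inv_le_iff_of_pos (by positivity) (by positivity) hu,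
        Real.mul_rpow (by positivity) hT0.le, ← Real.rpow_mul hX0.le]
      have hTT : (T : ℝ) ^ (3 - 2 * α) = T ^ (2 - 2 * α) * T := by
        rw [← Real.rpow_add_one hT0.ne']; ring_nf
      calc S ^ (2 - 2 * α) * T * X ^ (-(2 * η))
          ≤ (X ^ (θ - ε)) ^ (2 - 2 * α) * T * X ^ (-(2 * η)) := by gcongr
        _ = X ^ ((2 - 2 * α) * (θ - ε) - 2 * η) * T := by
            rw [← Real.rpow_mul hX0.le, mul_right_comm, ← Real.rpow_add hX0]; ring_nf
        _ ≤ X ^ (-(2 * c) * (3 - 2 * α) + (1 + ε) * (2 - 2 * α)) * T := by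
            gcongr
            nlinarith
        _ = X ^ (-(2 * c) * (3 - 2 * α)) * ((X ^ (1 + ε)) ^ (2 - 2 * α) * T) := by
            rw [Real.rpow_add hX0, Real.rpow_mul hX0.le (1 + ε), mul_assoc]
        _ ≤ X ^ (-(2 * c) * (3 - 2 * α)) * ((T : ℝ) ^ (2 - 2 * α) * T) := by gcongr
        _ = _ := by rw [hTT]
    calc boundFactor α η δ T S X k * T * X
        ≤ (3 * (X ^ (-(2 * c)) * T)) * T * X := by
          unfold boundFactor
          gcongr
          linarith
      _ ≤ (X ^ c * (X ^ (-(2 * c)) * T)) * T * X := by gcongr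
      _ = (X ^ c * X ^ (-(2 * c))) * (X * (T : ℝ) ^ 2) := by ring
      _ = _ := by rw [← Real.rpow_add hX0]; ring_nf

/-- With `η = 1 / 16 - 3δ / 8` the condition on `(β + η) / (1 - α)` is an equality, and `θ = 7 / 6` is
the point at which the saving vanishes with `ε` and `δ`. -/
theorem powerSaving_heathBrown_konyagin {ε : ℝ} (hε : 0 < ε) :
    PowerSaving (5 / 8) (1 / 8) (7 / 6) ε := by
  have hm : 0 < min ε (1 / 12) := lt_min hε (by norm_num)
  have hmε := min_le_left ε (1 / 12)
  have hm12 := min_le_right ε (1 / 12)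
  set δ := min ε (1 / 12)
  refine powerSaving_of_exponents (η := 1 / 16 - 3 * δ / 8) (δ := δ) (c₀ := ε / 4) (by norm_num) hε
    (by linarith) hm (by linarith) ?_ ?_ ?_ ?_
  · rw [div_le_iff₀ (by norm_num)]; linarith
  · norm_num; linarith
  · norm_num; linarith
  · norm_num; linarith

/-- With `η = ϑ (1 / 2 - δ - ζ)` the condition on `(β + η) / (1 - α)` is an equality. The saving in
the exponent is of order `ϑ (2ε - δ - ζ)`, whence `δ, ζ ≤ ε / 2`. -/
theorem powerSaving_bourgain_glibichuk_konyagin {ε ζ ϑ : ℝ} (hε : 0 < ε) (hζ : 0 < ζ)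
    (hζε : ζ ≤ min (ε / 2) (1 / 8)) (hϑ : 0 < ϑ) (hϑ5 : ϑ ≤ 1 / 5) :
    PowerSaving (1 - ϑ) (ζ * ϑ) (3 / 2) ε := by
  have hδ : 0 < min (ε / 2) (1 / 8) := lt_min (by linarith) (by norm_num)
  have hδε := min_le_left (ε / 2) (1 / 8)
  have hδ8 := min_le_right (ε / 2) (1 / 8)
  set δ := min (ε / 2) (1 / 8)
  have hu : 0 < 3 - 2 * (1 - ϑ) := by linarith
  have hδϑ : δ * ϑ ≤ ε / 2 * ϑ := by gcongr
  have hζϑ : ζ * ϑ ≤ δ * ϑ := by gcongr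
  have hζϑ0 : 0 < ζ * ϑ := by positivity
  have hδϑ0 : 0 < δ * ϑ := by positivity
  have hεϑ0 : 0 < ε * ϑ := by positivity
  have hδϑ8 : δ * ϑ ≤ 1 / 8 * ϑ := by gcongr
  refine powerSaving_of_exponents (η := ϑ * (1 / 2 - δ - ζ)) (δ := δ) (c₀ := ε * ϑ)
    (by linarith) hε (by nlinarith) hδ hεϑ0 ?_ ?_ ?_ ?_
  · rw [div_le_iff₀ (by linarith)]; nlinarith
  · -- `(1 + 2ϑ)² ≤ 2` holds for `ϑ ≤ 1 / 5`
    have h1 : 1 / 2 + ϑ ≤ 1 / (3 - 2 * (1 - ϑ)) := by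
      rw [le_div_iff₀ hu]; nlinarith
    have h2 : 0 < 1 / (3 - 2 * (1 - ϑ)) := by positivity
    nlinarith
  · rw [div_add' _ _ _ hu.ne']
    refine div_pos ?_ hu
    nlinarith
  · nlinarith

end ExpSieve

theorem theorem2p1 :
    (∀ l : ℤ, 2 ≤ l → ∀ α β η δ : ℝ, α < 1 → ExpSieve.Admissible α β → 0 < η → 0 < δ →
      (β + η) / (1 - α) ≤ 1 / 2 - δ →
      ∀ ε : ℝ, 0 < ε → ∃ X₀ : ℝ, ∀ (X S Δ : ℝ) (T k : ℕ),
        X₀ ≤ X → 0 < S → 1 < Δ → 1 ≤ k →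
        ExpSieve.Compatible α η T S X Δ k →
        ∀ (γ : Fin T → ℂ) (s : Fin T → ℕ), (∀ n, ‖γ n‖ ≤ 1) → StrictMono s →
          (∀ n, (s n : ℝ) ≤ S) →
          ExpSieve.V l γ s X Δ
            ≤ ExpSieve.boundFactor α η δ T S X k * T * X ^ (1 + ε)) ∧
    (∀ ε : ℝ, 0 < ε → ExpSieve.PowerSaving (5 / 8) (1 / 8) (7 / 6) ε) ∧
    (∀ ε : ℝ, 0 < ε → ∃ ζ₀ : ℝ, 0 < ζ₀ ∧ ∀ ζ ϑ : ℝ, 0 < ζ → ζ ≤ ζ₀ → 0 < ϑ → ϑ ≤ 1 / 5 →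
      ExpSieve.PowerSaving (1 - ϑ) (ζ * ϑ) (3 / 2) ε) := by
  refine ⟨fun l hl α β η δ hα hadm hη hδ hβδ ε hε => ?_,
    fun ε hε => ExpSieve.powerSaving_heathBrown_konyagin hε,
    fun ε hε => ⟨min (ε / 2) (1 / 8), lt_min (by linarith) (by norm_num),
      fun ζ ϑ hζ hζε hϑ hϑ5 =>
        ExpSieve.powerSaving_bourgain_glibichuk_konyagin hε hζ hζε hϑ hϑ5⟩⟩
  obtain ⟨K, hK⟩ := ExpSieve.V_le hl hα hadm hη hδ hβδ (ε / 12) (by positivity)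
  obtain ⟨X₁, hX₁⟩ := Filter.eventually_atTop.1
    ((tendsto_rpow_atTop (half_pos hε)).eventually_ge_atTop K)
  refine ⟨max 1 X₁, fun X S Δ T k hX hS hΔ _ _ γ s hγ hs hsS => ?_⟩
  have hX1 : 1 ≤ X := (le_max_left _ _).trans hX
  have hX0 : 0 < X := by linarith
  have hbf : 0 ≤ ExpSieve.boundFactor α η δ T S X k := by
    unfold ExpSieve.boundFactor
    positivity
  calc ExpSieve.V l γ s X Δ
      ≤ K * X ^ (6 * (ε / 12)) * (ExpSieve.boundFactor α η δ T S X k * T * X) :=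
        hK X S Δ T k hX1 hS hΔ γ s hγ hs hsS
    _ ≤ X ^ (ε / 2) * X ^ (6 * (ε / 12)) * (ExpSieve.boundFactor α η δ T S X k * T * X) := by
        gcongr
        exact hX₁ X ((le_max_right _ _).trans hX)
    _ = ExpSieve.boundFactor α η δ T S X k * T * (X * (X ^ (ε / 2) * X ^ (6 * (ε / 12)))) := by
        ring
    _ = _ := by
        rw [← Real.rpow_add hX0, ← Real.rpow_one_add' hX0.le (by linarith)]
        ring_nf
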